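/- **Setting.** Let $(E,\|\cdot\|)$ be a real separable Banach space and $(\Omega,\mathcal F,\mathbb P)$ a probability space. Let $\{X^x_t\}_{t\ge 0}$, $x\in E$, be a family of $E$-valued time-homogeneous Markov processes with $X^x_0=x$. For $h\in[0,\tilde h]$ let $E^h\subset E$ be a closed linear subspace with the norm of $E$, with $E^0=E$ (for instance, $E^h$ finite-dimensional for $h>0$), and let $x\mapsto x^h$ be a map from $E$ to $E^h$ with $x^h=x$ for $x\in E^h$. For a step-size $\Delta=(h,\tau)$ put $t_k=k\tau$ and let $\{Y^{u,\Delta}_{t_k}\}_{k\in\mathbb N}$, $u\in E^h$, be a family of $E^h$-valued processes with $Y^{u,\Delta}_0=u$; put $Y^{u,\Delta}_t=Y^{u,\Delta}_{t_k}$ for $t\in[t_k,t_{k+1})$. A probability measure $\nu$ is invariant for a time-homogeneous Markov family if $\int \mathbb P(Z^x_t\in A)\,\nu(\mathrm dx)=\nu(A)$ for all times $t$ and Borel sets $A$. Write $\nu(f)=\int f\,\mathrm d\nu$. For $p\ge1$, $\gamma\in(0,1]$ let $\mathcal C_{p,\gamma}$ be the set of continuous $f:E\to\mathbb R$ with $$\|f\|_{p,\gamma}:=\sup_{u}\frac{|f(u)|}{1+\|u\|^{p/2}}+\sup_{u_1\ne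 u_2}\frac{|f(u_1)-f(u_2)|}{(1\wedge\|u_1-u_2\|^{\gamma})(1+\|u_1\|^p+\|u_2\|^p)^{1/2}}<\infty .$$ **Assumption 1 (exact process).** There are $r\ge2$, $\tilde r\ge1$, $L_1>0$, $\gamma_1\in(0,1]$, $\beta\in[0,r-1]$, $L_2>0$ and a continuous $\rho:[0,\infty)\to[0,\infty)$ with $\int_0^\infty\rho^{\gamma_1}(t)\,\mathrm dt<\infty$ such that for all $x,y\in E$ $$\sup_{t\ge0}\mathbb E\|X^x_t\|^r\le L_1(1+\|x\|^{\tilde r r}),\qquad \big(\mathbb E\|X^x_t-X^y_t\|^2\big)^{1/2}\le L_2\|x-y\|(1+\|x\|^\beta+\|y\|^\beta)\rho(t)\quad(t\ge0).$$ **Assumption 2 (discretization).** There are $\tilde h\in[0,1]$, $\tilde\tau\in(0,1]$ such that for all $h\in[0,\tilde h]$, $\tau\in(0,\tilde\tau]$ the family $\{Y^{u,\Delta}_{t_k}\}_{k\in\mathbb N}$, $u\in E^h$, is time-homogeneous Markov, and there are constants $q\ge2$, $\tilde q\ge1$, $L_3>0$, $\gamma_2\in(0,1]$, $\kappa\in[0,q-1]$,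 $L_4>0$, independent of $\Delta$, and functions $\rho^\Delta:[0,\infty)\to[0,\infty)$ with $\sup_{h\in[0,\tilde h],\,\tau\in(0,\tilde\tau]}\tau\sum_{k\ge0}(\rho^\Delta(t_k))^{\gamma_2}<\infty$ such that for all these $\Delta$ and all $u,v\in E^h$ $$\sup_{k\ge0}\mathbb E\|Y^{u,\Delta}_{t_k}\|^q\le L_3(1+\|u\|^{\tilde q q}),\qquad \big(\mathbb E\|Y^{u,\Delta}_{t_k}-Y^{v,\Delta}_{t_k}\|^2\big)^{1/2}\le L_4\|u-v\|(1+\|u\|^\kappa+\|v\|^\kappa)\rho^\Delta(t_k)\quad(k\ge0).$$ **Assumption 3 (strong error).** There are $\alpha_1,\alpha_2>0$ and $L_5>0$ such that, with $|\Delta^\alpha|:=h^{\alpha_1}+\tau^{\alpha_2}$, for all $x\in E$, $h\in[0,\tilde h]$, $\tau\in(0,\tilde\tau]$ $$\sup_{t\ge0}\big(\mathbb E\|X^x_t-Y^{x^h,\Delta}_t\|^2\big)^{1/2}\le L_5(1+\|x\|^{\tilde r\vee\tilde q})|\Delta^\alpha|.$$ **Theorem (numerical strong law of large numbers).** Let Assumptions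 1–3 hold, let $\gamma\in[\gamma_2,1]$, and let $p\ge1$ satisfy $p(1+\tilde q)+2(1+\kappa)\gamma\le q$. Then $\{X^x_t\}$ has a unique invariant probability measure $\mu$ on $E$, for every $\Delta=(h,\tau)\in[0,\tilde h]\times(0,\tilde\tau]$ the family $\{Y^{u,\Delta}_{t_k}\}$ has a unique invariant probability measure $\mu^\Delta$ on $E^h$, and there is a constant $K$, independent of $\Delta$ and $f$, such that every $f\in\mathcal C_{p,\gamma}$ is integrable with respect to $\mu$ and to all $\mu^\Delta$, and: 1. for every such $\Delta$ and every $u\in E^h$, $\displaystyle\lim_{k\to\infty}\frac1k\sum_{i=0}^{k-1}f(Y^{u,\Delta}_{t_i})=\mu^\Delta(f)$ almost surely; 2. $|\mu(f)-\mu^\Delta(f)|\le K\|f\|_{p,\gamma}|\Delta^\alpha|^\gamma$ for every such $\Delta$; 3. consequently $\displaystyle\lim_{|\Delta|\to0}\lim_{k\to\infty}\frac1k\sum_{i=0}^{k-1}f(Y^{x^h,\Delta}_{t_i})=\mu(f)$ almost surely for every $x\in E$, in the following sense: $\mu^\Delta(f)\to\mu(f)$ as $|\Delta|\to0$, and for every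 sequence $\Delta_n=(h_n,\tau_n)\to(0,0)$ of such step-sizes, almost surely the limits $\ell_n=\lim_{k\to\infty}\frac1k\sum_{i=0}^{k-1}f(Y^{x^{h_n},\Delta_n}_{i\tau_n})$ exist for all $n$ and $\ell_n\to\mu(f)$. -/

import Mathlib

open MeasureTheory Set Filter Topology
open scoped NNReal ENNReal

/-- A time-homogeneous Markov family `Z x t`, indexed by its deterministic initial value `x : S` and
by time `t : T` (`T = ℝ≥0` or `T = ℕ`), on the probability space `(Ω, P)`. Its transition
probabilities are `p_t(y, A) = P (Z y t ∈ A)`, and each `Z x` is adapted to, and has the Markov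
property with these transition probabilities relative to, some filtration. -/
structure IsMarkovFamily {Ω S T : Type*} [mΩ : MeasurableSpace Ω] [MeasurableSpace S]
    [AddMonoid T] [Preorder T] (P : Measure Ω) (Z : S → T → Ω → S) : Prop where
  measurable : ∀ x t, Measurable (Z x t)
  initial : ∀ x, ∀ᵐ ω ∂P, Z x 0 ω = x
  measurable_transition : ∀ (t : T) (A : Set S), MeasurableSet A →
    Measurable fun y => P (Z y t ⁻¹' A)
  markov : ∀ x, ∃ 𝓕 : Filtration T mΩ, (∀ t, Measurable[𝓕 t] (Z x t)) ∧
    ∀ (s t : T) (A : Set S), MeasurableSet A →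
      condExp (𝓕 s) P ((Z x (s + t) ⁻¹' A).indicator fun _ => (1 : ℝ))
        =ᵐ[P] fun ω => (P (Z (Z x s ω) t ⁻¹' A)).toReal

/-- `ν` is an invariant probability measure of the family `Z`:
`∫ P (Z x t ∈ A) ν(dx) = ν A` for all times `t` and all measurable `A`. -/
def IsInvariantProb {Ω S T : Type*} [MeasurableSpace Ω] [MeasurableSpace S]
    (P : Measure Ω) (Z : S → T → Ω → S) (ν : Measure S) : Prop :=
  IsProbabilityMeasure ν ∧
    ∀ (t : T) (A : Set S), MeasurableSet A → ∫⁻ x, P (Z x t ⁻¹' A) ∂ν = ν A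

/-- `ν` is the unique invariant probability measure of the family `Z`. -/
def IsUniqueInvariantProb {Ω S T : Type*} [MeasurableSpace Ω] [MeasurableSpace S]
    (P : Measure Ω) (Z : S → T → Ω → S) (ν : Measure S) : Prop :=
  IsInvariantProb P Z ν ∧ ∀ ν' : Measure S, IsInvariantProb P Z ν' → ν' = ν

/-- The quasi-metric `(1 ∧ ‖u - v‖ ^ γ) (1 + ‖u‖ ^ p + ‖v‖ ^ p) ^ (1/2)`. -/
noncomputable def quasiDist {E : Type*} [NormedAddCommGroup E] (p γ : ℝ) (u v : E) : ℝ :=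
  min 1 (‖u - v‖ ^ γ) * √(1 + ‖u‖ ^ p + ‖v‖ ^ p)

/-- The norm `‖f‖_{p,γ}`, with values in `[0, ∞]`. -/
noncomputable def testNorm {E : Type*} [NormedAddCommGroup E] (p γ : ℝ) (f : E → ℝ) : ℝ≥0∞ :=
  (⨆ u : E, ENNReal.ofReal (|f u| / (1 + ‖u‖ ^ (p / 2)))) +
    ⨆ (u : E) (v : E) (_ : u ≠ v), ENNReal.ofReal (|f u - f v| / quasiDist p γ u v)

/-- The space `C_{p,γ}` of continuous functions with finite `(p,γ)`-norm. -/
def MemTestSpace {E : Type*} [NormedAddCommGroup E] (p γ : ℝ) (f : E → ℝ) : Prop :=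
  Continuous f ∧ testNorm p γ f < ∞

/-- The admissible step sizes `Δ = (h, τ)`, `h ∈ [0, hmax]`, `τ ∈ (0, τmax]`. -/
def stepSizes (hmax τmax : ℝ) : Set (ℝ × ℝ) := Icc 0 hmax ×ˢ Ioc 0 τmax

/-- Moment bound and mixing for the exact process. -/
structure ExactAssumption {Ω E : Type*} [MeasurableSpace Ω] [NormedAddCommGroup E]
    [MeasurableSpace E] (P : Measure Ω) (X : E → ℝ≥0 → Ω → E)
    (r rt L₁ γ₁ β L₂ : ℝ) (ρ : ℝ → ℝ) : Prop where
  markov : IsMarkovFamily P X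
  two_le_r : 2 ≤ r
  one_le_rt : 1 ≤ rt
  L₁_pos : 0 < L₁
  moment : ∀ (x : E) (t : ℝ≥0),
    ∫⁻ ω, ENNReal.ofReal (‖X x t ω‖ ^ r) ∂P ≤ ENNReal.ofReal (L₁ * (1 + ‖x‖ ^ (rt * r)))
  γ₁_mem : γ₁ ∈ Ioc (0 : ℝ) 1
  β_mem : β ∈ Icc 0 (r - 1)
  L₂_pos : 0 < L₂
  ρ_nonneg : ∀ t, 0 ≤ t → 0 ≤ ρ t
  ρ_continuous : ContinuousOn ρ (Ici 0)
  ρ_integrable : IntegrableOn (fun t => ρ t ^ γ₁) (Ici 0)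
  mixing : ∀ (x y : E) (t : ℝ≥0),
    eLpNorm (fun ω => X x t ω - X y t ω) 2 P ≤
      ENNReal.ofReal (L₂ * ‖x - y‖ * (1 + ‖x‖ ^ β + ‖y‖ ^ β) * ρ t)

/-- Moment bound and mixing for the discretization. For `Δ = (h, τ)` the chain
`k ↦ Y h τ u k` is the discretization at the times `t_k = k τ`, started at `u ∈ E^h = V h`. -/
structure DiscreteAssumption {Ω E : Type*} [MeasurableSpace Ω] [NormedAddCommGroup E]
    [NormedSpace ℝ E] [MeasurableSpace E] (P : Measure Ω) (V : ℝ → Submodule ℝ E)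
    (Y : (h τ : ℝ) → V h → ℕ → Ω → V h) (hmax τmax : ℝ)
    (q qt L₃ γ₂ κ L₄ : ℝ) (ρΔ : ℝ → ℝ → ℝ → ℝ) : Prop where
  hmax_mem : hmax ∈ Icc (0 : ℝ) 1
  τmax_mem : τmax ∈ Ioc (0 : ℝ) 1
  markov : ∀ h ∈ Icc 0 hmax, ∀ τ ∈ Ioc 0 τmax, IsMarkovFamily P (Y h τ)
  two_le_q : 2 ≤ q
  one_le_qt : 1 ≤ qt
  L₃_pos : 0 < L₃
  moment : ∀ h ∈ Icc 0 hmax, ∀ τ ∈ Ioc 0 τmax, ∀ (u : V h) (k : ℕ),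
    ∫⁻ ω, ENNReal.ofReal (‖Y h τ u k ω‖ ^ q) ∂P ≤ ENNReal.ofReal (L₃ * (1 + ‖u‖ ^ (qt * q)))
  γ₂_mem : γ₂ ∈ Ioc (0 : ℝ) 1
  κ_mem : κ ∈ Icc 0 (q - 1)
  L₄_pos : 0 < L₄
  ρΔ_nonneg : ∀ h ∈ Icc 0 hmax, ∀ τ ∈ Ioc 0 τmax, ∀ t, 0 ≤ t → 0 ≤ ρΔ h τ t
  ρΔ_summable : (⨆ h ∈ Icc 0 hmax, ⨆ τ ∈ Ioc 0 τmax,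
    ENNReal.ofReal τ * ∑' k : ℕ, ENNReal.ofReal (ρΔ h τ (k * τ) ^ γ₂)) < ∞
  mixing : ∀ h ∈ Icc 0 hmax, ∀ τ ∈ Ioc 0 τmax, ∀ (u v : V h) (k : ℕ),
    eLpNorm (fun ω => Y h τ u k ω - Y h τ v k ω) 2 P ≤
      ENNReal.ofReal (L₄ * ‖u - v‖ * (1 + ‖u‖ ^ κ + ‖v‖ ^ κ) * ρΔ h τ (k * τ))

/-- Strong error bound, uniform in time. The map `π h` sends `x` to the discrete initial value
`x^h`, and the piecewise constant interpolation of the chain equals its `⌊t / τ⌋`-th value at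
time `t`. -/
structure StrongErrorAssumption {Ω E : Type*} [MeasurableSpace Ω] [NormedAddCommGroup E]
    [NormedSpace ℝ E] (P : Measure Ω) (X : E → ℝ≥0 → Ω → E)
    (V : ℝ → Submodule ℝ E) (Y : (h τ : ℝ) → V h → ℕ → Ω → V h) (π : (h : ℝ) → E → V h)
    (hmax τmax rt qt α₁ α₂ L₅ : ℝ) : Prop where
  α₁_pos : 0 < α₁
  α₂_pos : 0 < α₂
  L₅_pos : 0 < L₅
  error : ∀ h ∈ Icc 0 hmax, ∀ τ ∈ Ioc 0 τmax, ∀ (x : E) (t : ℝ≥0),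
    eLpNorm (fun ω => X x t ω - (Y h τ (π h x) ⌊(t : ℝ) / τ⌋₊ ω : E)) 2 P ≤
      ENNReal.ofReal (L₅ * (1 + ‖x‖ ^ max rt qt) * (h ^ α₁ + τ ^ α₂))

/-- The time average `(1/k) ∑_{i<k} f (Z_i)` of an `E`-valued sequence at the point `ω`. -/
noncomputable def timeAverage {Ω E : Type*} (f : E → ℝ) (Z : ℕ → Ω → E) (ω : Ω) (k : ℕ) : ℝ :=
  (1 / (k : ℝ)) * ∑ i ∈ Finset.range k, f (Z i ω)

/-! Mixing makes trajectories with different starting points merge. By the Markov property at time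
`u`, the law at time `u + t` from the origin is the law at time `t` restarted from a random point of
bounded moments. Against Lipschitz functions it therefore differs from the law at time `t` by a
multiple of the mixing rate at `t`. Laws along times at which the rate vanishes are thus Cauchy.
They converge by a tightness argument (`exists_tendsto_of_lipschitz_cauchy`), and the limit is the
unique invariant measure (`IsMarkovFamily.exists_isUniqueInvariantProb`). This serves both the exact
process and every chain.

For the strong law, Cauchy–Schwarz (`abs_integral_sub_le_of_weighted_holder`) turns mean-square
mixing into a bound by `ρ k ^ γ` times polynomial weights for the difference of the expectations of
`f` from two starting points. Averaging one point over the invariant measure and conditioning at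
time `i` gives centred products at lag `k` of expectation O(`ρ k ^ γ`), uniformly in `i`; the
relation between `p` and `q` makes the weights integrable. These bounds are summable, so
`strong_law_of_summable_cov` applies.

For the error of the invariant measures, both processes start at the origin. The same Hölder
estimate, fed with the strong error, bounds the difference of expectations uniformly in time, and
time is sent to infinity. The required moments of order `q` of the exact process come from the
chains with `h = 0`, `τ → 0` and Fatou's lemma. The iterated limit then involves only countably many
null sets. -/

open ProbabilityTheory

/-! ### Weak convergence tested on bounded Lipschitz functions. -/

section WeakConvergence

variable {S : Type*} [MeasurableSpace S] [PseudoEMetricSpace S]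

lemma tendsto_of_forall_lipschitz [OpensMeasurableSpace S] {ι : Type*} {l : Filter ι}
    [l.IsCountablyGenerated] {μs : ι → ProbabilityMeasure S} {μ : ProbabilityMeasure S}
    (h : ∀ f : S → ℝ, (∃ C, ∀ x, |f x| ≤ C) → (∃ L, LipschitzWith L f) →
      Tendsto (fun i => ∫ y, f y ∂(μs i : Measure S)) l (𝓝 (∫ y, f y ∂(μ : Measure S)))) :
    Tendsto μs l (𝓝 μ) := by
  refine tendsto_iff_forall_lipschitz_integral_tendsto.2 fun f ⟨C, hC⟩ hL => h f ?_ hL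
  obtain ⟨x₀⟩ := μ.nonempty
  refine ⟨C + |f x₀|, fun x => ?_⟩
  have h1 := hC x x₀
  rw [Real.dist_eq] at h1
  linarith [abs_sub_abs_le_abs_sub (f x) (f x₀)]

/-- The constant sequence `μ` converges weakly to `ν`, and weak limits are unique. -/
lemma ext_of_forall_lipschitz [BorelSpace S] {μ ν : Measure S} [IsProbabilityMeasure μ]
    [IsProbabilityMeasure ν]
    (h : ∀ f : S → ℝ, (∃ C, ∀ x, |f x| ≤ C) → (∃ L, LipschitzWith L f) →
      ∫ y, f y ∂μ = ∫ y, f y ∂ν) : μ = ν := by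
  set μ' : ProbabilityMeasure S := ⟨μ, inferInstance⟩
  set ν' : ProbabilityMeasure S := ⟨ν, inferInstance⟩
  have h1 : Tendsto (fun _ : ℕ => μ') atTop (𝓝 ν') :=
    tendsto_of_forall_lipschitz fun f hC hL => by simp [μ', ν', h f hC hL]
  exact congrArg ProbabilityMeasure.toMeasure (tendsto_nhds_unique tendsto_const_nhds h1)

end WeakConvergence

/-! ### Transition kernels and the Markov property for integrals. -/

section MarkovFamily

variable {Ω S T : Type*} [mΩ : MeasurableSpace Ω] [MeasurableSpace S] [AddMonoid T] [Preorder T]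
  {P : Measure Ω} {Z : S → T → Ω → S}

/-- The transition kernel `y ↦ law of Z y t` of a Markov family. -/
noncomputable def IsMarkovFamily.kernel (hZ : IsMarkovFamily P Z) (t : T) : Kernel S S where
  toFun y := P.map (Z y t)
  measurable' := by
    refine Measure.measurable_of_measurable_coe _ fun A hA => ?_
    simp_rw [Measure.map_apply (hZ.measurable _ t) hA]
    exact hZ.measurable_transition t A hA

lemma IsMarkovFamily.kernel_apply (hZ : IsMarkovFamily P Z) (t : T) (y : S) :
    hZ.kernel t y = P.map (Z y t) := rfl

lemma IsMarkovFamily.measurable_integral (hZ : IsMarkovFamily P Z) (t : T)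
    {f : S → ℝ} (hf : Measurable f) : Measurable fun y => ∫ ω, f (Z y t ω) ∂P := by
  have : (fun y => ∫ ω, f (Z y t ω) ∂P) = fun y => ∫ z, f z ∂(hZ.kernel t y) := by
    ext y
    rw [hZ.kernel_apply, integral_map (hZ.measurable _ t).aemeasurable hf.aestronglyMeasurable]
  rw [this]
  exact (hf.stronglyMeasurable.integral_kernel).measurable

lemma IsMarkovFamily.isInvariantProb_iff (hZ : IsMarkovFamily P Z) (ν : Measure S) :
    IsInvariantProb P Z ν ↔ IsProbabilityMeasure ν ∧ ∀ t, (hZ.kernel t) ∘ₘ ν = ν := by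
  refine and_congr_right fun _ => forall_congr' fun t => ?_
  rw [Measure.ext_iff]
  refine forall₂_congr fun A hA => ?_
  rw [Measure.bind_apply hA (Kernel.aemeasurable _)]
  simp_rw [hZ.kernel_apply, Measure.map_apply (hZ.measurable _ t) hA]

variable [IsProbabilityMeasure P]

instance (hZ : IsMarkovFamily P Z) (t : T) : IsMarkovKernel (hZ.kernel t) :=
  ⟨fun y => Measure.isProbabilityMeasure_map (hZ.measurable y t).aemeasurable⟩

/-- The joint law of the values at times `s` and `s + t`. -/
lemma IsMarkovFamily.map_prodMk (hZ : IsMarkovFamily P Z) (x : S) (s t : T) :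
    P.map (fun ω => (Z x s ω, Z x (s + t) ω)) = (P.map (Z x s)) ⊗ₘ hZ.kernel t := by
  have hs := hZ.measurable x s
  have hst := hZ.measurable x (s + t)
  have : IsProbabilityMeasure (P.map (Z x s)) :=
    Measure.isProbabilityMeasure_map hs.aemeasurable
  have : IsProbabilityMeasure (P.map (fun ω => (Z x s ω, Z x (s + t) ω))) :=
    Measure.isProbabilityMeasure_map (hs.prodMk hst).aemeasurable
  refine Measure.ext_prod fun {B A} hB hA => ?_
  obtain ⟨𝓕, had, hmk⟩ := hZ.markov x
  have hB' : MeasurableSet[𝓕 s] (Z x s ⁻¹' B) := had s hB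
  have hAm : MeasurableSet (Z x (s + t) ⁻¹' A) := hst hA
  have hBm : MeasurableSet (Z x s ⁻¹' B) := hs hB
  rw [Measure.map_apply (hs.prodMk hst) (hB.prod hA), Measure.compProd_apply_prod hB hA,
    setLIntegral_map hB ((hZ.kernel t).measurable_coe hA) hs]
  -- The event `Z x s ∈ B` belongs to `𝓕 s`, so the conditional expectation may be integrated over
  -- it.
  have h1 : (∫ ω in Z x s ⁻¹' B, ((Z x (s + t) ⁻¹' A).indicator fun _ => (1 : ℝ)) ω ∂P)
      = ∫ ω in Z x s ⁻¹' B, (P (Z (Z x s ω) t ⁻¹' A)).toReal ∂P := by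
    rw [← setIntegral_condExp (𝓕.le s) ((integrable_const (1 : ℝ)).indicator hAm) hB']
    exact integral_congr_ae (ae_restrict_of_ae (hmk s t A hA))
  rw [integral_indicator hAm, setIntegral_const, smul_eq_mul, mul_one, Measure.real,
    Measure.restrict_apply hAm, integral_toReal] at h1
  · have hne : (∫⁻ ω in Z x s ⁻¹' B, P (Z (Z x s ω) t ⁻¹' A) ∂P) ≠ ∞ := by
      refine ne_top_of_le_ne_top (b := 1) (by simp) ?_
      refine (lintegral_mono (g := fun _ => (1 : ℝ≥0∞)) fun _ => prob_le_one).trans ?_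
      simpa using prob_le_one
    have h2 := (ENNReal.toReal_eq_toReal_iff' (measure_ne_top _ _) hne).1 h1
    rw [show (fun ω => (Z x s ω, Z x (s + t) ω)) ⁻¹' B ×ˢ A
      = Z x (s + t) ⁻¹' A ∩ Z x s ⁻¹' B by ext; simp [and_comm], h2]
    refine lintegral_congr fun ω => ?_
    rw [hZ.kernel_apply, Measure.map_apply (hZ.measurable _ t) hA]
  · exact ((hZ.measurable_transition t A hA).comp hs).aemeasurable
  · exact Eventually.of_forall fun _ => measure_lt_top _ _

lemma IsMarkovFamily.integrable_pair_iff (hZ : IsMarkovFamily P Z) (x : S) (s t : T)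
    {g f : S → ℝ} (hg : Measurable g) (hf : Measurable f) :
    Integrable (fun y : S × S => g y.1 * f y.2) ((P.map (Z x s)) ⊗ₘ hZ.kernel t) ↔
      Integrable (fun ω => g (Z x s ω) * f (Z x (s + t) ω)) P := by
  rw [← hZ.map_prodMk x s t, integrable_map_measure (by fun_prop)
    ((hZ.measurable x s).prodMk (hZ.measurable x (s + t))).aemeasurable]
  rfl

/-- Markov property for expectations of products. -/
lemma IsMarkovFamily.integral_mul (hZ : IsMarkovFamily P Z) (x : S) (s t : T)
    {g f : S → ℝ} (hg : Measurable g) (hf : Measurable f)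
    (hgf : Integrable (fun ω => g (Z x s ω) * f (Z x (s + t) ω)) P) :
    ∫ ω, g (Z x s ω) * f (Z x (s + t) ω) ∂P =
      ∫ ω, g (Z x s ω) * (∫ ω', f (Z (Z x s ω) t ω') ∂P) ∂P := by
  have hs := hZ.measurable x s
  have hst := hZ.measurable x (s + t)
  have : IsProbabilityMeasure (P.map (Z x s)) :=
    Measure.isProbabilityMeasure_map hs.aemeasurable
  have h1 := integral_map (μ := P) (hs.prodMk hst).aemeasurable
    (f := fun y : S × S => g y.1 * f y.2) (by fun_prop)
  rw [← h1, hZ.map_prodMk, Measure.integral_compProd ((hZ.integrable_pair_iff x s t hg hf).2 hgf),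
    integral_map hs.aemeasurable]
  · refine integral_congr_ae (Eventually.of_forall fun ω => ?_)
    simp only [integral_const_mul]
    rw [hZ.kernel_apply, integral_map (hZ.measurable _ t).aemeasurable (by fun_prop)]
  · have hm : StronglyMeasurable fun y : S × S => g y.1 * f y.2 :=
      Measurable.stronglyMeasurable (by fun_prop)
    exact (hm.integral_kernel_prod_right' (κ := hZ.kernel t)).aestronglyMeasurable

/-- Chapman–Kolmogorov equation for expectations. -/
lemma IsMarkovFamily.integral_add (hZ : IsMarkovFamily P Z) (x : S) (s t : T)
    {f : S → ℝ} (hf : Measurable f) (hi : Integrable (fun ω => f (Z x (s + t) ω)) P) :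
    ∫ ω, f (Z x (s + t) ω) ∂P = ∫ ω, (∫ ω', f (Z (Z x s ω) t ω') ∂P) ∂P := by
  simpa using hZ.integral_mul x s t (g := fun _ => 1) measurable_const hf (by simpa using hi)

/-- Invariance says that `ν` is the second marginal of `ν ⊗ₘ hZ.kernel t`; Fubini for this product
extends it from sets to integrable functions. -/
lemma IsInvariantProb.integral_eq {ν : Measure S} (hν : IsInvariantProb P Z ν)
    (hZ : IsMarkovFamily P Z) (t : T) {f : S → ℝ} (hf : Measurable f) (hi : Integrable f ν) :
    ∫ y, f y ∂ν = ∫ y, (∫ ω, f (Z y t ω) ∂P) ∂ν := by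
  obtain ⟨_, h⟩ := (hZ.isInvariantProb_iff ν).1 hν
  have h' := h t
  rw [← Measure.snd_compProd, Measure.snd] at h'
  rw [← h', integrable_map_measure hf.aestronglyMeasurable measurable_snd.aemeasurable] at hi
  conv_lhs => rw [← h']
  rw [integral_map measurable_snd.aemeasurable hf.aestronglyMeasurable,
    Measure.integral_compProd (f := fun y : S × S => f y.2) hi]
  refine integral_congr_ae (Eventually.of_forall fun y => ?_)
  simp only
  rw [hZ.kernel_apply, integral_map (hZ.measurable _ t).aemeasurable hf.aestronglyMeasurable]

lemma IsMarkovFamily.isInvariantProb_of_integral [PseudoEMetricSpace S] [BorelSpace S]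
    (hZ : IsMarkovFamily P Z) (ν : Measure S) [IsProbabilityMeasure ν]
    (h : ∀ t (f : S → ℝ), (∃ C, ∀ x, |f x| ≤ C) → (∃ L, LipschitzWith L f) →
      ∫ y, (∫ ω, f (Z y t ω) ∂P) ∂ν = ∫ y, f y ∂ν) : IsInvariantProb P Z ν := by
  refine (hZ.isInvariantProb_iff ν).2 ⟨inferInstance, fun t => ?_⟩
  refine ext_of_forall_lipschitz fun f ⟨C, hC⟩ ⟨L, hL⟩ => ?_
  have hf := hL.continuous.measurable
  rw [← h t f ⟨C, hC⟩ ⟨L, hL⟩, ← Measure.snd_compProd, Measure.snd,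
    integral_map measurable_snd.aemeasurable hf.aestronglyMeasurable,
    Measure.integral_compProd (f := fun y : S × S => f y.2)]
  · refine integral_congr_ae (Eventually.of_forall fun y => ?_)
    simp only
    rw [hZ.kernel_apply, integral_map (hZ.measurable _ t).aemeasurable hf.aestronglyMeasurable]
  · exact Integrable.of_bound (hf.comp measurable_snd).aestronglyMeasurable C
      (Eventually.of_forall fun y => hC _)

/-- Law of `Z x t` as a probability measure. -/
noncomputable def IsMarkovFamily.law (hZ : IsMarkovFamily P Z)
    (x : S) (t : T) : ProbabilityMeasure S :=
  ⟨P.map (Z x t), Measure.isProbabilityMeasure_map (hZ.measurable x t).aemeasurable⟩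

lemma IsMarkovFamily.integral_law (hZ : IsMarkovFamily P Z)
    (x : S) (t : T) {f : S → ℝ} (hf : Measurable f) :
    ∫ y, f y ∂(hZ.law x t : Measure S) = ∫ ω, f (Z x t ω) ∂P :=
  integral_map (hZ.measurable x t).aemeasurable hf.aestronglyMeasurable

end MarkovFamily

/-! ### Completeness of probability measures under Lipschitz tests. -/

section Completeness

variable {F : Type*} [MetricSpace F] [CompleteSpace F] [SecondCountableTopology F]
  [MeasurableSpace F] [BorelSpace F]

/-- The first `N + 1` measures are tight, hence nearly carried by one compact set `D`. A Lipschitz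
cutoff vanishing on `D` and equal to 1 away from it transfers the smallness of the mass from `μs N`
to all later measures, at the price of thickening `D`. -/
lemma exists_finite_measure_compl_le_of_lipschitz_cauchy {μs : ℕ → ProbabilityMeasure F}
    {a : ℕ → ℝ} (ha : Tendsto a atTop (𝓝 0))
    (h : ∀ (f : F → ℝ) (K : ℝ≥0), (∃ C, ∀ x, |f x| ≤ C) → LipschitzWith K f → ∀ n m,
      |∫ y, f y ∂(μs n : Measure F) - ∫ y, f y ∂(μs m : Measure F)| ≤ K * (a n + a m))
    {δ ε : ℝ} (hδ : 0 < δ) (hε : 0 < ε) :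
    ∃ t : Set F, t.Finite ∧
      ∀ n, (μs n : Measure F).real (⋃ x ∈ t, Metric.closedBall x δ)ᶜ ≤ ε := by
  -- The Lipschitz constant of the indicator thickened by `δ / 2`. The other half of `δ` is spent on
  -- covering `D` by balls.
  set K : ℝ≥0 := (δ / 2).toNNReal⁻¹ with hK
  obtain ⟨N, hN⟩ : ∃ N, ∀ n ≥ N, K * (a n + a N) ≤ ε / 2 := by
    have hη : 0 < ε / 2 / (2 * (K + 1 : ℝ)) := by positivity
    obtain ⟨N, hN⟩ := eventually_atTop.1 (ha.eventually_lt_const hη)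
    refine ⟨N, fun n hn => ?_⟩
    have h1 : a n + a N ≤ 2 * (ε / 2 / (2 * (K + 1 : ℝ))) := by
      linarith [hN n hn, hN N le_rfl]
    calc K * (a n + a N) ≤ K * (2 * (ε / 2 / (2 * (K + 1 : ℝ)))) := by gcongr
      _ = ε / 2 * (K / (K + 1 : ℝ)) := by field_simp
      _ ≤ ε / 2 * 1 := by
        gcongr
        rw [div_le_one (by positivity)]
        linarith
      _ = ε / 2 := mul_one _
  have hC : ∀ i, ∃ C : Set F, IsCompact C ∧ (μs i : Measure F).real Cᶜ ≤ ε / 2 := fun i => by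
    obtain ⟨C, hC, hC'⟩ := isTightMeasureSet_iff_exists_isCompact_measure_compl_le.1
      (isTightMeasureSet_singleton (μ := (μs i : Measure F))) (ENNReal.ofReal (ε / 2))
      (by positivity)
    exact ⟨C, hC, ENNReal.toReal_le_of_le_ofReal (by positivity) (hC' _ rfl)⟩
  choose C hCc hC using hC
  set D := ⋃ i ∈ Finset.range (N + 1), C i with hD
  have hDc : IsCompact D := (Finset.range (N + 1)).isCompact_biUnion fun i _ => hCc i
  have hDμ : ∀ i ≤ N, (μs i : Measure F).real Dᶜ ≤ ε / 2 := fun i hi =>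
    (measureReal_mono (compl_subset_compl.2
      (subset_biUnion_of_mem (u := C) (Finset.mem_coe.2 (Finset.mem_range.2 (by omega)))))).trans (hC i)
  obtain ⟨t, htf, ht⟩ := Metric.totallyBounded_iff.1 hDc.totallyBounded (δ / 2) (by positivity)
  have hsub : Metric.thickening (δ / 2) D ⊆ ⋃ x ∈ t, Metric.closedBall x δ := fun y hy => by
    obtain ⟨z, hz, hyz⟩ := Metric.mem_thickening_iff.1 hy
    obtain ⟨x, hx, hzx⟩ := mem_iUnion₂.1 (ht hz)
    refine mem_iUnion₂.2 ⟨x, hx, ?_⟩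
    rw [Metric.mem_ball] at hzx
    rw [Metric.mem_closedBall]
    linarith [dist_triangle y z x]
  refine ⟨t, htf, fun n => (measureReal_mono (compl_subset_compl.2 hsub)).trans ?_⟩
  rcases le_total n N with hn | hn
  · refine (measureReal_mono (compl_subset_compl.2 ?_)).trans ((hDμ n hn).trans (by linarith))
    exact Metric.self_subset_thickening (by positivity) D
  set g : F → ℝ := fun y => 1 - thickenedIndicator (δ := δ / 2) (by positivity) D y with hg
  have hglip : LipschitzWith K g := by
    have h1 := (lipschitzWith_thickenedIndicator (δ := δ / 2) (by positivity) D)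
    refine LipschitzWith.of_dist_le_mul fun x y => ?_
    have h2 := h1.dist_le_mul x y
    rw [NNReal.dist_eq] at h2
    rw [Real.dist_eq, abs_sub_comm]
    simpa only [hg, sub_sub_sub_cancel_left] using h2
  have hg0 : ∀ y, 0 ≤ g y := fun y => by
    simp only [hg, sub_nonneg]
    exact_mod_cast thickenedIndicator_le_one _ D y
  have hg1 : ∀ y, g y ≤ 1 := fun y => by simp [hg]
  have hgb : ∀ y, |g y| ≤ 1 := fun y => by rw [abs_of_nonneg (hg0 y)]; exact hg1 y
  have hgi : ∀ i, Integrable g (μs i : Measure F) := fun i =>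
    Integrable.of_bound hglip.continuous.measurable.aestronglyMeasurable 1
      (Eventually.of_forall hgb)
  have hup : ∫ y, g y ∂(μs N : Measure F) ≤ ε / 2 := by
    refine le_trans ?_ (hDμ N le_rfl)
    rw [← integral_indicator_one hDc.isClosed.measurableSet.compl]
    refine integral_mono (hgi N)
      ((integrable_const (1 : ℝ)).indicator hDc.isClosed.measurableSet.compl) fun y => ?_
    by_cases hy : y ∈ D
    · have hy0 : g y = 0 := by
        simp only [hg, thickenedIndicator_one (δ := δ / 2) (by positivity) D hy, NNReal.coe_one,
          sub_self]
      simp [hy0, hy]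
    · simp [hy, hg1]
  have hlow : (μs n : Measure F).real (Metric.thickening (δ / 2) D)ᶜ
      ≤ ∫ y, g y ∂(μs n : Measure F) := by
    rw [← integral_indicator_one Metric.isOpen_thickening.measurableSet.compl]
    refine integral_mono
      ((integrable_const (1 : ℝ)).indicator Metric.isOpen_thickening.measurableSet.compl)
      (hgi n) fun y => ?_
    by_cases hy : y ∈ Metric.thickening (δ / 2) D
    · simp [hy, hg0]
    · have hy1 : g y = 1 := by
        simp only [hg, thickenedIndicator_zero (δ := δ / 2) (by positivity) D hy, NNReal.coe_zero,
          sub_zero]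
      simp [hy1, hy]
  have h3 := (le_abs_self _).trans (h g K ⟨1, hgb⟩ hglip n N)
  linarith [hN n hn]

/-- A sequence of probability measures on a Polish space that is Cauchy when tested against
Lipschitz functions converges weakly. -/
lemma exists_tendsto_of_lipschitz_cauchy {μs : ℕ → ProbabilityMeasure F}
    {a : ℕ → ℝ} (ha : Tendsto a atTop (𝓝 0))
    (h : ∀ (f : F → ℝ) (K : ℝ≥0), (∃ C, ∀ x, |f x| ≤ C) → LipschitzWith K f → ∀ n m,
      |∫ y, f y ∂(μs n : Measure F) - ∫ y, f y ∂(μs m : Measure F)| ≤ K * (a n + a m)) :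
    ∃ μ, Tendsto μs atTop (𝓝 μ) := by
  have htight : IsTightMeasureSet {((μ : ProbabilityMeasure F) : Measure F) | μ ∈ range μs} := by
    refine isTightMeasureSet_iff_exists_isCompact_measure_compl_le.2 fun ε hε => ?_
    -- At scale `1 / (k + 1)` mass at most `e k` is lost. Intersecting the finite unions of balls
    -- over all scales leaves a closed totally bounded set, which is compact.
    obtain ⟨e, he0, he⟩ := ENNReal.exists_pos_sum_of_countable hε.ne' ℕ
    choose t htf ht using fun k : ℕ => exists_finite_measure_compl_le_of_lipschitz_cauchy ha h
      (δ := 1 / ((k : ℝ) + 1)) (ε := e k) (by positivity) (by exact_mod_cast he0 k)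
    set A : ℕ → Set F := fun k => ⋃ x ∈ t k, Metric.closedBall x (1 / ((k : ℝ) + 1)) with hA
    have hAc : IsClosed (⋂ k, A k) :=
      isClosed_iInter fun k => (htf k).isClosed_biUnion fun x _ => Metric.isClosed_closedBall
    refine ⟨⋂ k, A k, TotallyBounded.isCompact_of_isClosed ?_ hAc, ?_⟩
    · refine Metric.totallyBounded_iff.2 fun δ hδ => ?_
      obtain ⟨k, hk⟩ := exists_nat_one_div_lt hδ
      refine ⟨t k, htf k, (iInter_subset A k).trans ?_⟩
      exact iUnion₂_mono fun x _ => Metric.closedBall_subset_ball hk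
    · rintro _ ⟨_, ⟨n, rfl⟩, rfl⟩
      rw [compl_iInter]
      refine (measure_iUnion_le _).trans (le_trans (ENNReal.tsum_le_tsum fun k => ?_) he.le)
      rw [← ENNReal.ofReal_coe_nnreal, ← ofReal_measureReal]
      exact ENNReal.ofReal_le_ofReal (ht k n)
  -- Prokhorov's theorem yields a cluster point; for each test function the integrals form a Cauchy
  -- sequence, so clustering is convergence.
  have hcomp := isCompact_closure_of_isTightMeasureSet htight
  obtain ⟨μ, -, hμ⟩ := hcomp.exists_mapClusterPt (f := atTop) (u := μs)
    (tendsto_principal.2 (Eventually.of_forall fun n => subset_closure (mem_range_self n)))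
  refine ⟨μ, tendsto_of_forall_lipschitz fun f hC ⟨K, hK⟩ => ?_⟩
  have hcont : Continuous fun ν : ProbabilityMeasure F => ∫ y, f y ∂(ν : Measure F) := by
    obtain ⟨C, hC⟩ := hC
    exact ProbabilityMeasure.continuous_integral_boundedContinuousFunction
      (BoundedContinuousFunction.ofNormedAddCommGroup f hK.continuous C hC)
  have hcl : MapClusterPt (∫ y, f y ∂(μ : Measure F)) atTop
      (fun n => ∫ y, f y ∂(μs n : Measure F)) := hμ.continuousAt_comp hcont.continuousAt
  have hcs : CauchySeq fun n => ∫ y, f y ∂(μs n : Measure F) := by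
    refine Metric.cauchySeq_iff'.2 fun ε hε => ?_
    have hη : 0 < ε / (2 * (K + 1 : ℝ)) := by positivity
    obtain ⟨N, hN⟩ := eventually_atTop.1 (ha.eventually_lt_const hη)
    refine ⟨N, fun n hn => (h f K hC hK n N).trans_lt ?_⟩
    have h1 : a n + a N ≤ 2 * (ε / (2 * (K + 1 : ℝ))) := by linarith [hN n hn, hN N le_rfl]
    calc K * (a n + a N) ≤ K * (2 * (ε / (2 * (K + 1 : ℝ)))) := by gcongr
      _ = ε * (K / (K + 1 : ℝ)) := by field_simp
      _ < ε * 1 := by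
        gcongr
        rw [div_lt_one (by positivity)]
        linarith
      _ = ε := mul_one _
  exact le_nhds_of_cauchy_adhp hcs hcl

end Completeness

/-! ### Elementary growth and integrability bounds. -/

section Moments

lemma norm_mul_growth_le {F : Type*} [NormedAddCommGroup F] {b m : ℝ} (hb : 0 ≤ b) (hm : 1 + b ≤ m) (y : F) :
    ‖y‖ * (1 + ‖y‖ ^ b + ‖(0 : F)‖ ^ b) ≤ 3 * (1 + ‖y‖ ^ m) := by
  -- For `b = 0` this power is 1, not 0.
  have h0 : ‖(0 : F)‖ ^ b ≤ 1 := by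
    rw [norm_zero]
    exact Real.rpow_le_one le_rfl zero_le_one hb
  have hy := norm_nonneg y
  rcases le_total ‖y‖ 1 with h | h
  · have h1 : ‖y‖ ^ b ≤ 1 := Real.rpow_le_one hy h hb
    have h2 : 0 ≤ ‖y‖ ^ m := by positivity
    have h3 : ‖y‖ * (1 + ‖y‖ ^ b + ‖(0 : F)‖ ^ b) ≤ 1 * 3 :=
      mul_le_mul h (by linarith) (by positivity) zero_le_one
    linarith
  · have h1 : 1 ≤ ‖y‖ ^ b := Real.one_le_rpow h hb
    have h2 : ‖y‖ * ‖y‖ ^ b ≤ ‖y‖ ^ m := by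
      rw [← Real.rpow_one_add' hy (by linarith)]
      exact Real.rpow_le_rpow_of_exponent_le h hm
    calc ‖y‖ * (1 + ‖y‖ ^ b + ‖(0 : F)‖ ^ b) ≤ ‖y‖ * (3 * ‖y‖ ^ b) := by
          gcongr
          linarith
      _ = 3 * (‖y‖ * ‖y‖ ^ b) := by ring
      _ ≤ 3 * (1 + ‖y‖ ^ m) := by linarith

variable {Ω : Type*} [MeasurableSpace Ω] {P : Measure Ω}

lemma integrable_of_lintegral_ofReal_le {g : Ω → ℝ} {A : ℝ} (hg : Measurable g)
    (hg0 : ∀ ω, 0 ≤ g ω) (hA : 0 ≤ A)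
    (h : ∫⁻ ω, ENNReal.ofReal (g ω) ∂P ≤ ENNReal.ofReal A) :
    Integrable g P ∧ ∫ ω, g ω ∂P ≤ A := by
  refine ⟨⟨hg.aestronglyMeasurable, ?_⟩, ?_⟩
  · rw [hasFiniteIntegral_iff_ofReal (Eventually.of_forall hg0)]
    exact h.trans_lt ENNReal.ofReal_lt_top
  · rw [integral_eq_lintegral_of_nonneg_ae (Eventually.of_forall hg0) hg.aestronglyMeasurable]
    exact ENNReal.toReal_le_of_le_ofReal hA h

lemma integrable_of_eLpNorm_two_le [IsProbabilityMeasure P] {F : Type*} [NormedAddCommGroup F]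
    {U : Ω → F} {d : ℝ} (hU : AEStronglyMeasurable U P) (hd : 0 ≤ d)
    (h : eLpNorm U 2 P ≤ ENNReal.ofReal d) : Integrable U P ∧ ∫ ω, ‖U ω‖ ∂P ≤ d := by
  have h1 : eLpNorm U 1 P ≤ ENNReal.ofReal d :=
    (eLpNorm_le_eLpNorm_of_exponent_le (by norm_num) hU).trans h
  refine ⟨memLp_one_iff_integrable.1 ⟨hU, h1.trans_lt ENNReal.ofReal_lt_top⟩, ?_⟩
  rw [integral_norm_eq_lintegral_enorm hU, ← eLpNorm_one_eq_lintegral_enorm]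
  exact ENNReal.toReal_le_of_le_ofReal hd h1

end Moments

/-! ### Existence and uniqueness of invariant measures. -/

section Ergodicity

variable {Ω F T : Type*} [MeasurableSpace Ω] {P : Measure Ω} [IsProbabilityMeasure P]
  [NormedAddCommGroup F] [SecondCountableTopology F] [MeasurableSpace F] [BorelSpace F]
  {Z : F → T → Ω → F}

lemma abs_integral_sub_le_of_lipschitz {U W : Ω → F} (hU : Measurable U) (hW : Measurable W)
    {d : ℝ} (hd : 0 ≤ d) (h : eLpNorm (fun ω => U ω - W ω) 2 P ≤ ENNReal.ofReal d)
    {f : F → ℝ} {K : ℝ≥0} (hf : LipschitzWith K f) {C : ℝ} (hC : ∀ x, |f x| ≤ C) :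
    |∫ ω, f (U ω) ∂P - ∫ ω, f (W ω) ∂P| ≤ K * d := by
  have hfm := hf.continuous.measurable
  have hi : ∀ {V : Ω → F}, Measurable V → Integrable (fun ω => f (V ω)) P := fun hV =>
    Integrable.of_bound (hfm.comp hV).aestronglyMeasurable C (Eventually.of_forall fun ω => hC _)
  obtain ⟨h1, h2⟩ := integrable_of_eLpNorm_two_le
    (hU.sub hW).aestronglyMeasurable hd h
  rw [← integral_sub (hi hU) (hi hW)]
  calc |∫ ω, (f (U ω) - f (W ω)) ∂P| ≤ ∫ ω, |f (U ω) - f (W ω)| ∂P :=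
        abs_integral_le_integral_abs
    _ ≤ ∫ ω, K * ‖U ω - W ω‖ ∂P := by
        refine integral_mono ((hi hU).sub (hi hW)).abs (h1.norm.const_mul _) fun ω => ?_
        simpa [Real.dist_eq, dist_eq_norm] using hf.dist_le_mul (U ω) (W ω)
    _ = K * ∫ ω, ‖U ω - W ω‖ ∂P := integral_const_mul _ _
    _ ≤ K * d := mul_le_mul_of_nonneg_left h2 K.2

/-- A Markov family whose trajectories contract in mean along a sequence of times, and which has
bounded moments when started at the origin, has a unique invariant probability measure. -/
theorem IsMarkovFamily.exists_isUniqueInvariantProb [CompleteSpace F] [AddCommMonoid T]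
    [Preorder T] (hZ : IsMarkovFamily P Z) {b m M : ℝ} (hb : 0 ≤ b) (hm : 1 + b ≤ m) (hM : 0 ≤ M)
    {c : T → ℝ} (hc : ∀ t, 0 ≤ c t)
    (hmix : ∀ x y t, eLpNorm (fun ω => Z x t ω - Z y t ω) 2 P ≤
      ENNReal.ofReal (‖x - y‖ * (1 + ‖x‖ ^ b + ‖y‖ ^ b) * c t))
    (hmom : ∀ t, ∫⁻ ω, ENNReal.ofReal (‖Z 0 t ω‖ ^ m) ∂P ≤ ENNReal.ofReal M)
    {s : ℕ → T} (hs : Tendsto (fun n => c (s n)) atTop (𝓝 0)) :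
    ∃ ν : ProbabilityMeasure F, IsUniqueInvariantProb P Z (ν : Measure F) ∧
      Tendsto (fun n => hZ.law 0 (s n)) atTop (𝓝 ν) := by
  have hmom' : ∀ t, Integrable (fun ω => ‖Z 0 t ω‖ ^ m) P ∧ ∫ ω, ‖Z 0 t ω‖ ^ m ∂P ≤ M :=
    fun t => integrable_of_lintegral_ofReal_le ((hZ.measurable 0 t).norm.pow_const m)
      (fun _ => by positivity) hM (hmom t)
  have hdiff : ∀ (f : F → ℝ) (K : ℝ≥0), (∃ C, ∀ x, |f x| ≤ C) → LipschitzWith K f → ∀ x y t,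
      |∫ ω, f (Z x t ω) ∂P - ∫ ω, f (Z y t ω) ∂P| ≤
        K * (‖x - y‖ * (1 + ‖x‖ ^ b + ‖y‖ ^ b) * c t) := fun f K ⟨C, hC⟩ hf x y t =>
    abs_integral_sub_le_of_lipschitz (hZ.measurable x t) (hZ.measurable y t)
      (mul_nonneg (by positivity) (hc t)) (hmix x y t) hf hC
  have hint : ∀ (f : F → ℝ), Measurable f → (∃ C, ∀ x, |f x| ≤ C) → ∀ x t,
      Integrable (fun ω => f (Z x t ω)) P := fun f hf ⟨C, hC⟩ x t =>
    Integrable.of_bound (hf.comp (hZ.measurable x t)).aestronglyMeasurable C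
      (Eventually.of_forall fun ω => hC _)
  have hbdd : ∀ (f : F → ℝ) C, (∀ x, |f x| ≤ C) → ∀ x t, |∫ ω, f (Z x t ω) ∂P| ≤ C :=
    fun f C hC x t => by
      have := norm_integral_le_of_norm_le_const (μ := P) (f := fun ω => f (Z x t ω)) (C := C)
        (Eventually.of_forall fun ω => hC _)
      simpa using this
  set D := 3 * (1 + M) with hD
  -- Restart at time `u`: a run from the random point `Z 0 u` is compared with a run from 0, and the
  -- weight is averaged by the moment bound. The estimate is uniform in `u`.
  have hshift : ∀ (f : F → ℝ) (K : ℝ≥0), (∃ C, ∀ x, |f x| ≤ C) → LipschitzWith K f → ∀ u t,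
      |∫ ω, f (Z 0 (u + t) ω) ∂P - ∫ ω, f (Z 0 t ω) ∂P| ≤ K * (D * c t) := by
    intro f K hC hf u t
    have hfm := hf.continuous.measurable
    have hPm := hZ.measurable_integral t hfm
    have hPi : Integrable (fun ω => ∫ ω', f (Z (Z 0 u ω) t ω') ∂P) P := by
      obtain ⟨C, hC⟩ := hC
      exact Integrable.of_bound (hPm.comp (hZ.measurable 0 u)).aestronglyMeasurable C
        (Eventually.of_forall fun ω => hbdd f C hC _ _)
    rw [hZ.integral_add 0 u t hfm (hint f hfm hC _ _)]
    have h1 : ∫ ω, f (Z 0 t ω) ∂P = ∫ _, (∫ ω, f (Z 0 t ω) ∂P) ∂P := by simp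
    rw [h1, ← integral_sub hPi (integrable_const _)]
    calc _ ≤ ∫ ω, |(∫ ω', f (Z (Z 0 u ω) t ω') ∂P) - ∫ ω, f (Z 0 t ω) ∂P| ∂P :=
          abs_integral_le_integral_abs
      _ ≤ ∫ ω, K * c t * 3 * (1 + ‖Z 0 u ω‖ ^ m) ∂P := by
          refine integral_mono (hPi.sub (integrable_const _)).abs
            (((integrable_const 1).add (hmom' u).1).const_mul _) fun ω => ?_
          refine (hdiff f K hC hf _ _ _).trans ?_
          have := norm_mul_growth_le hb hm (Z 0 u ω)
          rw [sub_zero]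
          calc K * (‖Z 0 u ω‖ * (1 + ‖Z 0 u ω‖ ^ b + ‖(0 : F)‖ ^ b) * c t)
              ≤ K * (3 * (1 + ‖Z 0 u ω‖ ^ m) * c t) := by
                have := hc t
                gcongr
            _ = K * c t * 3 * (1 + ‖Z 0 u ω‖ ^ m) := by ring
      _ = K * c t * 3 * (1 + ∫ ω, ‖Z 0 u ω‖ ^ m ∂P) := by
          rw [integral_const_mul, MeasureTheory.integral_add (integrable_const _) (hmom' u).1]
          simp
      _ ≤ K * c t * 3 * (1 + M) := by
          have := hc t
          have := (hmom' u).2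
          gcongr
      _ = K * (D * c t) := by rw [hD]; ring
  -- The laws at times `s n` and `s k` are both compared with the law at `s n + s k`; commutativity
  -- of time allows either to be the final stretch.
  obtain ⟨ν, hν⟩ := exists_tendsto_of_lipschitz_cauchy (μs := fun n => hZ.law 0 (s n))
    (a := fun n => D * c (s n)) (by simpa using hs.const_mul D) (fun f K hC hf n k => by
      rw [hZ.integral_law _ _ hf.continuous.measurable, hZ.integral_law _ _ hf.continuous.measurable]
      have h1 := hshift f K hC hf (s k) (s n)
      have h2 := hshift f K hC hf (s n) (s k)
      rw [add_comm (s k)] at h1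
      rw [abs_sub_comm] at h1
      calc _ ≤ _ := abs_sub_le _ (∫ ω, f (Z 0 (s n + s k) ω) ∂P) _
        _ ≤ _ := add_le_add h1 h2
        _ = _ := by ring)
  have hlim : ∀ (g : F → ℝ), Continuous g → (∃ C, ∀ x, |g x| ≤ C) →
      Tendsto (fun n => ∫ ω, g (Z 0 (s n) ω) ∂P) atTop (𝓝 (∫ y, g y ∂(ν : Measure F))) := by
    intro g hg ⟨C, hC⟩
    have h1 := (ProbabilityMeasure.tendsto_iff_forall_integral_tendsto.1 hν)
      (BoundedContinuousFunction.ofNormedAddCommGroup g hg C hC)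
    refine h1.congr fun n => ?_
    exact hZ.integral_law _ _ hg.measurable
  have hlim' : ∀ (f : F → ℝ) (K : ℝ≥0), (∃ C, ∀ x, |f x| ≤ C) → LipschitzWith K f → ∀ y,
      Tendsto (fun n => ∫ ω, f (Z y (s n) ω) ∂P) atTop (𝓝 (∫ y, f y ∂(ν : Measure F))) := by
    intro f K hC hf y
    refine (hlim f hf.continuous hC).congr_dist (squeeze_zero (fun _ => dist_nonneg)
      (fun n => ?_) (?_ : Tendsto (fun n => K * (‖(0 : F) - y‖ * (1 + ‖(0 : F)‖ ^ b + ‖y‖ ^ b) *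
        c (s n))) atTop (𝓝 0)))
    · rw [Real.dist_eq]
      exact hdiff f K hC hf 0 y (s n)
    · simpa using (hs.const_mul (‖(0 : F) - y‖ * (1 + ‖(0 : F)‖ ^ b + ‖y‖ ^ b))).const_mul (K : ℝ)
  refine ⟨ν, ⟨hZ.isInvariantProb_of_integral _ fun t f hC ⟨K, hf⟩ => ?_, fun ν' hν' => ?_⟩, hν⟩
  -- By this Feller property weak convergence applies to the transition operator of `f`. Its
  -- expectation at time `s n` is that of `f` at `s n + t`, which `hshift` compares with time `s n`.
  · have hcont : Continuous fun y => ∫ ω, f (Z y t ω) ∂P := by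
      refine continuous_iff_continuousAt.2 fun x => ?_
      refine tendsto_iff_dist_tendsto_zero.2 (squeeze_zero (fun _ => dist_nonneg)
        (fun y => (Real.dist_eq _ _).trans_le (hdiff f K hC hf y x t)) ?_)
      have : Continuous fun y : F => K * (‖y - x‖ * (1 + ‖y‖ ^ b + ‖x‖ ^ b) * c t) := by
        have : Continuous fun y : F => ‖y‖ ^ b := continuous_norm.rpow_const fun _ => Or.inr hb
        fun_prop
      simpa using this.tendsto x
    obtain ⟨C, hC⟩ := hC
    refine tendsto_nhds_unique (hlim _ hcont ⟨C, fun y => hbdd f C hC y t⟩) ?_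
    refine (hlim f hf.continuous ⟨C, hC⟩).congr_dist (squeeze_zero (fun _ => dist_nonneg)
      (fun n => ?_) (?_ : Tendsto (fun n => K * (D * c (s n))) atTop (𝓝 0)))
    · rw [Real.dist_eq, ← hZ.integral_add 0 (s n) t hf.continuous.measurable
        (hint f hf.continuous.measurable ⟨C, hC⟩ _ _), abs_sub_comm, add_comm]
      exact hshift f K ⟨C, hC⟩ hf t (s n)
    · simpa using (hs.const_mul D).const_mul (K : ℝ)
  · have := hν'.1
    refine ext_of_forall_lipschitz fun f ⟨C, hC⟩ ⟨K, hf⟩ => ?_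
    have hfm := hf.continuous.measurable
    -- This sequence is constant by invariance of `ν'`. It also tends to the integral against `ν` by
    -- dominated convergence, since all starting points share the same limit.
    refine tendsto_nhds_unique (f := fun n => ∫ y, (∫ ω, f (Z y (s n) ω) ∂P) ∂ν') (l := atTop) ?_ ?_
    · refine tendsto_const_nhds.congr fun n => ?_
      exact hν'.integral_eq hZ (s n) hfm (Integrable.of_bound hfm.aestronglyMeasurable C
        (Eventually.of_forall hC))
    · have h1 := tendsto_integral_of_dominated_convergence (μ := ν')
        (F := fun n y => ∫ ω, f (Z y (s n) ω) ∂P) (f := fun _ => ∫ y, f y ∂(ν : Measure F))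
        (fun _ => C) (fun n => (hZ.measurable_integral (s n) hfm).aestronglyMeasurable)
        (integrable_const _) (fun n => Eventually.of_forall fun y => hbdd f C hC y _)
        (Eventually.of_forall fun y => hlim' f K ⟨C, hC⟩ hf y)
      simpa using h1

end Ergodicity

/-! ### Moments and unbounded integrands under weak convergence. -/

section WeakLimit

variable {F : Type*} [MeasurableSpace F] [PseudoEMetricSpace F] [BorelSpace F]
  {μs : ℕ → ProbabilityMeasure F} {μ : ProbabilityMeasure F}

lemma lintegral_ofReal_le_of_tendsto (h : Tendsto μs atTop (𝓝 μ)) {g : F → ℝ}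
    (hg : Continuous g) (hg0 : ∀ y, 0 ≤ g y) {B : ℝ≥0∞}
    (hB : ∀ n, ∫⁻ y, ENNReal.ofReal (g y) ∂(μs n : Measure F) ≤ B) :
    ∫⁻ y, ENNReal.ofReal (g y) ∂(μ : Measure F) ≤ B := by
  refine (lintegral_le_liminf_lintegral_of_forall_isOpen_measure_le_liminf_measure
    (μs := fun n => (μs n : Measure F)) hg hg0 fun G hG =>
      ProbabilityMeasure.le_liminf_measure_open_of_tendsto h hG).trans ?_
  exact (liminf_le_liminf (Eventually.of_forall hB)).trans_eq (by simp)

lemma abs_sub_max_min_le_sq_div {N : ℝ} (hN : 0 < N) (x : ℝ) :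
    |x - max (-N) (min x N)| ≤ x ^ 2 / N := by
  have h0 : 0 ≤ x ^ 2 / N := by positivity
  rw [le_div_iff₀ hN]
  rcases le_total x N with h | h
  · rw [min_eq_left h]
    rcases le_total (-N) x with h' | h'
    · rw [max_eq_right h']
      simpa using sq_nonneg x
    · rw [max_eq_left h', abs_of_nonpos (by linarith)]
      nlinarith
  · rw [min_eq_right h, max_eq_right (by linarith), abs_of_nonneg (by linarith)]
    nlinarith

/-- Weak convergence together with bounded second moments of `f` gives convergence of the
integrals of `f`. -/
lemma tendsto_integral_of_sq_bounded (h : Tendsto μs atTop (𝓝 μ)) {f : F → ℝ}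
    (hf : Continuous f) {B : ℝ} (hB0 : 0 ≤ B)
    (hB : ∀ n, ∫⁻ y, ENNReal.ofReal (f y ^ 2) ∂(μs n : Measure F) ≤ ENNReal.ofReal B) :
    Tendsto (fun n => ∫ y, f y ∂(μs n : Measure F)) atTop (𝓝 (∫ y, f y ∂(μ : Measure F))) := by
  have hfm := hf.measurable
  -- Truncating `f` at level `N` costs at most `B / N`, uniformly over measures with second moment
  -- of `f` at most `B`.
  have htr : ∀ (ν : ProbabilityMeasure F),
      ∫⁻ y, ENNReal.ofReal (f y ^ 2) ∂(ν : Measure F) ≤ ENNReal.ofReal B → ∀ N : ℝ, 0 < N →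
      |∫ y, f y ∂(ν : Measure F) - ∫ y, max (-N) (min (f y) N) ∂(ν : Measure F)| ≤ B / N := by
    intro ν hν N hN
    obtain ⟨h1, h2⟩ := integrable_of_lintegral_ofReal_le (hfm.pow_const 2)
      (fun y => sq_nonneg (f y)) hB0 hν
    have hi : Integrable f (ν : Measure F) :=
      ((memLp_two_iff_integrable_sq hfm.aestronglyMeasurable).2 h1).integrable (by norm_num)
    have hi' : Integrable (fun y => max (-N) (min (f y) N)) (ν : Measure F) :=
      Integrable.of_bound (by fun_prop) N (Eventually.of_forall fun y => abs_le.2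
        ⟨le_max_left _ _, max_le (by linarith) (min_le_right _ _)⟩)
    rw [← integral_sub hi hi']
    calc _ ≤ ∫ y, |f y - max (-N) (min (f y) N)| ∂(ν : Measure F) := abs_integral_le_integral_abs
      _ ≤ ∫ y, f y ^ 2 / N ∂(ν : Measure F) :=
          integral_mono (hi.sub hi').abs (h1.div_const N) fun y =>
            abs_sub_max_min_le_sq_div hN (f y)
      _ ≤ B / N := by
          rw [integral_div]
          gcongr
  have hμ := lintegral_ofReal_le_of_tendsto h (hf.pow 2) (fun y => sq_nonneg (f y)) hB
  refine Metric.tendsto_atTop.2 fun ε hε => ?_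
  obtain ⟨N, hN, hN'⟩ : ∃ N : ℝ, 0 < N ∧ B / N < ε / 3 := by
    refine ⟨3 * (B + 1) / ε, by positivity, ?_⟩
    rw [div_lt_iff₀ (by positivity)]
    field_simp
    linarith
  have hconv := (ProbabilityMeasure.tendsto_iff_forall_integral_tendsto.1 h)
    (BoundedContinuousFunction.ofNormedAddCommGroup (fun y => max (-N) (min (f y) N))
      (by fun_prop) N (fun y => abs_le.2
        ⟨le_max_left _ _, max_le (by linarith) (min_le_right _ _)⟩))
  obtain ⟨n₀, hn₀⟩ := Metric.tendsto_atTop.1 hconv (ε / 3) (by positivity)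
  refine ⟨n₀, fun n hn => ?_⟩
  have h1 := htr (μs n) (hB n) N hN
  have h2 := htr μ hμ N hN
  have h3 := hn₀ n hn
  simp only [BoundedContinuousFunction.coe_ofNormedAddCommGroup] at h3
  rw [Real.dist_eq] at h3 ⊢
  rw [abs_lt] at h3 ⊢
  rw [abs_le] at h1 h2
  constructor <;> linarith [h1.1, h1.2, h2.1, h2.2, h3.1, h3.2]

end WeakLimit

/-! ### Pointwise bounds from the test norm. -/

section TestNorm

variable {E : Type*} [NormedAddCommGroup E] {p γ : ℝ} {f : E → ℝ}

lemma le_toReal_mul_of_ofReal_div_le {a b : ℝ} {N : ℝ≥0∞} (hN : N ≠ ∞) (hb : 0 < b)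
    (h : ENNReal.ofReal (a / b) ≤ N) : a ≤ N.toReal * b := by
  rw [← div_le_iff₀ hb]
  exact (ENNReal.ofReal_le_iff_le_toReal hN).1 h

lemma MemTestSpace.abs_le (hf : MemTestSpace p γ f) (u : E) :
    |f u| ≤ (testNorm p γ f).toReal * (1 + ‖u‖ ^ (p / 2)) := by
  refine le_toReal_mul_of_ofReal_div_le hf.2.ne (by positivity) ?_
  exact (le_iSup (fun u : E => ENNReal.ofReal (|f u| / (1 + ‖u‖ ^ (p / 2)))) u).trans
    le_self_add

lemma quasiDist_le (p γ : ℝ) (u v : E) :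
    quasiDist p γ u v ≤ ‖u - v‖ ^ γ * √(1 + ‖u‖ ^ p + ‖v‖ ^ p) :=
  mul_le_mul_of_nonneg_right (min_le_right _ _) (Real.sqrt_nonneg _)

/-- Only the Hölder part of `quasiDist` is kept, as mean-square closeness controls it directly. -/
lemma MemTestSpace.abs_sub_le (hf : MemTestSpace p γ f) (u v : E) :
    |f u - f v| ≤ (testNorm p γ f).toReal * (‖u - v‖ ^ γ * √(1 + ‖u‖ ^ p + ‖v‖ ^ p)) := by
  rcases eq_or_ne u v with rfl | huv
  · rw [sub_self, abs_zero]
    positivity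
  have hq : 0 < quasiDist p γ u v := by
    have : 0 < ‖u - v‖ := norm_pos_iff.2 (sub_ne_zero.2 huv)
    unfold quasiDist
    positivity
  refine (le_toReal_mul_of_ofReal_div_le hf.2.ne hq ?_).trans
    (mul_le_mul_of_nonneg_left (quasiDist_le p γ u v) ENNReal.toReal_nonneg)
  refine le_trans ?_ (le_add_self (a := ⨆ (u : E) (v : E) (_ : u ≠ v),
    ENNReal.ofReal (|f u - f v| / quasiDist p γ u v)))
  exact le_iSup_of_le u (le_iSup_of_le v (le_iSup_of_le huv le_rfl))

end TestNorm

/-! ### Weighted Hölder functions of two close random variables. -/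

section Holder

variable {Ω F : Type*} [MeasurableSpace Ω] {P : Measure Ω} [IsProbabilityMeasure P]
  [NormedAddCommGroup F]

/-- The L² norm of `‖U‖ ^ γ` is the `γ`-th power of the norm of `U` in L^{2γ}, and `2γ ≤ 2` on a
probability space. -/
lemma memLp_norm_rpow_of_eLpNorm_two_le {U : Ω → F} (hU : AEStronglyMeasurable U P) {d γ : ℝ}
    (hd : 0 ≤ d) (hγ : 0 < γ) (hγ1 : γ ≤ 1) (h : eLpNorm U 2 P ≤ ENNReal.ofReal d) :
    MemLp (fun ω => ‖U ω‖ ^ γ) 2 P ∧ (∫ ω, (‖U ω‖ ^ γ) ^ (2 : ℝ) ∂P) ^ (1 / (2 : ℝ)) ≤ d ^ γ := by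
  have h1 : eLpNorm (fun ω => ‖U ω‖ ^ γ) 2 P ≤ ENNReal.ofReal (d ^ γ) := by
    rw [eLpNorm_norm_rpow U hγ, ← ENNReal.ofReal_rpow_of_nonneg hd hγ.le]
    refine ENNReal.rpow_le_rpow ((eLpNorm_le_eLpNorm_of_exponent_le ?_ hU).trans h) hγ.le
    calc 2 * ENNReal.ofReal γ ≤ 2 * 1 := by
          gcongr
          exact ENNReal.ofReal_le_one.2 hγ1
      _ = 2 := mul_one _
  have h2 : MemLp (fun ω => ‖U ω‖ ^ γ) 2 P :=
    ⟨(hU.norm.aemeasurable.pow_const γ).aestronglyMeasurable, h1.trans_lt ENNReal.ofReal_lt_top⟩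
  refine ⟨h2, ?_⟩
  rw [h2.eLpNorm_eq_integral_rpow_norm (by norm_num) (by norm_num)] at h1
  have h3 := (ENNReal.ofReal_le_ofReal_iff (by positivity)).1 h1
  simpa [abs_of_nonneg (Real.rpow_nonneg (norm_nonneg _) _)] using h3

/-- Expectations of a function with a weighted Hölder bound, at two random variables that are close
in mean square. -/
lemma abs_integral_sub_le_of_weighted_holder {U W : Ω → F} (hU : AEStronglyMeasurable U P)
    (hW : AEStronglyMeasurable W P) {d γ p N A B : ℝ} (hd : 0 ≤ d) (hγ : 0 < γ) (hγ1 : γ ≤ 1)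
    (h : eLpNorm (fun ω => U ω - W ω) 2 P ≤ ENNReal.ofReal d)
    {f : F → ℝ} (hN : 0 ≤ N)
    (hf : ∀ u v, |f u - f v| ≤ N * (‖u - v‖ ^ γ * √(1 + ‖u‖ ^ p + ‖v‖ ^ p)))
    (hfU : Integrable (fun ω => f (U ω)) P) (hfW : Integrable (fun ω => f (W ω)) P)
    (hpU : Integrable (fun ω => ‖U ω‖ ^ p) P) (hpW : Integrable (fun ω => ‖W ω‖ ^ p) P)
    (hA : ∫ ω, ‖U ω‖ ^ p ∂P ≤ A) (hB : ∫ ω, ‖W ω‖ ^ p ∂P ≤ B) :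
    |∫ ω, f (U ω) ∂P - ∫ ω, f (W ω) ∂P| ≤ N * (d ^ γ * √(1 + A + B)) := by
  obtain ⟨ha, ha'⟩ := memLp_norm_rpow_of_eLpNorm_two_le (hU.sub hW) hd hγ hγ1 h
  have hpU1 : Integrable (fun ω => 1 + ‖U ω‖ ^ p) P := (integrable_const 1).add hpU
  have hsum : Integrable (fun ω => 1 + ‖U ω‖ ^ p + ‖W ω‖ ^ p) P := hpU1.add hpW
  have hsq : ∀ ω, √(1 + ‖U ω‖ ^ p + ‖W ω‖ ^ p) ^ 2 = 1 + ‖U ω‖ ^ p + ‖W ω‖ ^ p := fun ω =>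
    Real.sq_sqrt (by positivity)
  have hb : MemLp (fun ω => √(1 + ‖U ω‖ ^ p + ‖W ω‖ ^ p)) 2 P := by
    refine (memLp_two_iff_integrable_sq
      hsum.aestronglyMeasurable.aemeasurable.sqrt.aestronglyMeasurable).2 ?_
    simpa only [hsq] using hsum
  have hb' : ∫ ω, √(1 + ‖U ω‖ ^ p + ‖W ω‖ ^ p) ^ (2 : ℝ) ∂P ≤ 1 + A + B := by
    simp_rw [Real.rpow_two, hsq]
    rw [integral_add hpU1 hpW, integral_add (integrable_const 1) hpU]
    simp only [integral_const, probReal_univ, smul_eq_mul, mul_one]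
    linarith
  -- Cauchy–Schwarz separates the distance from the polynomial weight.
  have hcs := integral_mul_le_Lp_mul_Lq_of_nonneg (μ := P) Real.HolderConjugate.two_two
    (f := fun ω => ‖U ω - W ω‖ ^ γ) (g := fun ω => √(1 + ‖U ω‖ ^ p + ‖W ω‖ ^ p))
    (Eventually.of_forall fun ω => by positivity) (Eventually.of_forall fun ω => by positivity)
    (by simpa using ha) (by simpa using hb)
  rw [← integral_sub hfU hfW]
  calc _ ≤ ∫ ω, |f (U ω) - f (W ω)| ∂P := abs_integral_le_integral_abs
    _ ≤ ∫ ω, N * (‖U ω - W ω‖ ^ γ * √(1 + ‖U ω‖ ^ p + ‖W ω‖ ^ p)) ∂P :=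
        integral_mono (hfU.sub hfW).abs ((ha.integrable_mul hb).const_mul N) fun ω => hf _ _
    _ = N * ∫ ω, ‖U ω - W ω‖ ^ γ * √(1 + ‖U ω‖ ^ p + ‖W ω‖ ^ p) ∂P := integral_const_mul _ _
    _ ≤ N * (d ^ γ * √(1 + A + B)) := by
        refine mul_le_mul_of_nonneg_left (hcs.trans ?_) hN
        rw [Real.sqrt_eq_rpow]
        refine mul_le_mul ha' (Real.rpow_le_rpow ?_ hb' (by norm_num)) ?_ (by positivity)
        · exact integral_nonneg fun ω => by positivity
        · exact Real.rpow_nonneg (integral_nonneg fun ω => by positivity) _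

end Holder

/-! ### Strong law under summable correlations. -/

section StrongLaw

variable {Ω : Type*} [MeasurableSpace Ω] {P : Measure Ω} {Z : ℕ → Ω → ℝ} {a : ℕ → ℝ}

/-- Adding the variable `Z n` adds its correlations at lags `1, …, n`, each twice, and one at lag 0:
at most twice the full sum, whatever `n` is. -/
lemma integral_sum_sq_le (hZ : ∀ i, MemLp (Z i) 2 P) (ha0 : ∀ k, 0 ≤ a k) (ha : Summable a)
    (hcov : ∀ i k, |∫ ω, Z i ω * Z (i + k) ω ∂P| ≤ a k) (n : ℕ) :
    ∫ ω, (∑ i ∈ Finset.range n, Z i ω) ^ 2 ∂P ≤ 2 * (∑' k, a k) * n := by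
  induction n with
  | zero => simp
  | succ n ih =>
    have hS : MemLp (fun ω => ∑ i ∈ Finset.range n, Z i ω) 2 P :=
      memLp_finsetSum _ fun i _ => hZ i
    have hSS : Integrable (fun ω => (∑ i ∈ Finset.range n, Z i ω) ^ 2) P := hS.integrable_sq
    have hZZ : Integrable (fun ω => Z n ω ^ 2) P := (hZ n).integrable_sq
    have hmul : ∀ i, Integrable (fun ω => 2 * (Z i ω * Z n ω)) P := fun i =>
      ((hZ i).integrable_mul (hZ n)).const_mul 2
    have hsum : Integrable (fun ω => ∑ i ∈ Finset.range n, 2 * (Z i ω * Z n ω)) P :=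
      integrable_finsetSum _ fun i _ => hmul i
    have hexp : ∀ ω, (∑ i ∈ Finset.range (n + 1), Z i ω) ^ 2 =
        (∑ i ∈ Finset.range n, Z i ω) ^ 2 + ∑ i ∈ Finset.range n, 2 * (Z i ω * Z n ω)
          + Z n ω ^ 2 := fun ω => by
      rw [Finset.sum_range_succ, ← Finset.mul_sum, ← Finset.sum_mul]
      ring
    have hSsum : Integrable (fun ω => (∑ i ∈ Finset.range n, Z i ω) ^ 2 +
        ∑ i ∈ Finset.range n, 2 * (Z i ω * Z n ω)) P := hSS.add hsum
    simp_rw [hexp]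
    rw [integral_add hSsum hZZ, integral_add hSS hsum, integral_finsetSum _ fun i _ => hmul i]
    have h1 : ∑ i ∈ Finset.range n, ∫ ω, 2 * (Z i ω * Z n ω) ∂P
        ≤ 2 * ∑ k ∈ Finset.range n, a (k + 1) := by
      rw [← Finset.sum_range_reflect, Finset.mul_sum]
      refine Finset.sum_le_sum fun i hi => ?_
      have hi := Finset.mem_range.1 hi
      rw [integral_const_mul]
      have h2 := (le_abs_self _).trans (hcov (n - 1 - i) (i + 1))
      rw [show n - 1 - i + (i + 1) = n by omega] at h2
      linarith
    have h2 : ∫ ω, Z n ω ^ 2 ∂P ≤ a 0 := by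
      have := (le_abs_self _).trans (hcov n 0)
      simpa [sq] using this
    have h3 : ∑ k ∈ Finset.range n, a (k + 1) + a 0 ≤ ∑' k, a k := by
      rw [← Finset.sum_range_succ']
      exact ha.sum_le_tsum _ fun k _ => ha0 k
    have h4 := ha0 0
    push_cast
    linarith

/-- The series of squares has finite expectation, so it converges almost surely and its terms
vanish. -/
lemma tendsto_zero_of_summable_integral_sq {R : ℕ → Ω → ℝ} {b : ℕ → ℝ}
    (hR : ∀ n, MemLp (R n) 2 P) (hb : Summable b) (h : ∀ n, ∫ ω, R n ω ^ 2 ∂P ≤ b n) :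
    ∀ᵐ ω ∂P, Tendsto (fun n => R n ω) atTop (𝓝 0) := by
  have hb0 : ∀ n, 0 ≤ b n := fun n => (integral_nonneg fun ω => sq_nonneg _).trans (h n)
  have h1 : ∫⁻ ω, ∑' n, ENNReal.ofReal (R n ω ^ 2) ∂P ≠ ∞ := by
    rw [lintegral_tsum fun n =>
      ((hR n).integrable_sq.aestronglyMeasurable.aemeasurable).ennreal_ofReal]
    refine ne_top_of_le_ne_top (hb.tsum_ofReal_ne_top) (ENNReal.tsum_le_tsum fun n => ?_)
    rw [← ofReal_integral_eq_lintegral_ofReal (hR n).integrable_sq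
      (Eventually.of_forall fun ω => sq_nonneg _)]
    exact ENNReal.ofReal_le_ofReal (h n)
  have hm : AEMeasurable (fun ω => ∑' n, ENNReal.ofReal (R n ω ^ 2)) P :=
    AEMeasurable.tsum fun n =>
      ((hR n).integrable_sq.aestronglyMeasurable.aemeasurable).ennreal_ofReal
  filter_upwards [ae_lt_top' hm h1] with ω hω
  have h2 := ENNReal.tendsto_atTop_zero_of_tsum_ne_top hω.ne
  have h3 := (ENNReal.tendsto_toReal ENNReal.zero_ne_top).comp h2
  have h4 : Tendsto (fun n => √(R n ω ^ 2)) atTop (𝓝 0) := by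
    have := (Real.continuous_sqrt.tendsto 0).comp h3
    simpa [Function.comp_def, ENNReal.toReal_ofReal, sq_nonneg] using this
  simp_rw [Real.sqrt_sq_eq_abs] at h4
  exact (tendsto_zero_iff_abs_tendsto_zero _).2 h4

/-- Strong law of large numbers for square integrable variables with summable correlations. -/
theorem strong_law_of_summable_cov (hZ : ∀ i, MemLp (Z i) 2 P) (ha0 : ∀ k, 0 ≤ a k)
    (ha : Summable a) (hcov : ∀ i k, |∫ ω, Z i ω * Z (i + k) ω ∂P| ≤ a k) :
    ∀ᵐ ω ∂P, Tendsto (fun n : ℕ => (1 / (n : ℝ)) * ∑ i ∈ Finset.range n, Z i ω) atTop (𝓝 0) := by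
  set A := ∑' k, a k with hA
  have hA0 : 0 ≤ A := tsum_nonneg ha0
  have haA : a 0 ≤ A := ha.le_tsum 0 fun k _ => ha0 k
  set S : ℕ → Ω → ℝ := fun n ω => ∑ i ∈ Finset.range n, Z i ω with hS
  set B : ℕ → Ω → ℝ := fun N ω => ∑ i ∈ Finset.Ico (N ^ 2) ((N + 1) ^ 2), |Z i ω| with hB
  have hSm : ∀ n, MemLp (S n) 2 P := fun n => memLp_finsetSum _ fun i _ => hZ i
  have hBm : ∀ N, MemLp (B N) 2 P := fun N => memLp_finsetSum _ fun i _ => (hZ i).abs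
  have hZ2 : ∀ i, ∫ ω, Z i ω ^ 2 ∂P ≤ a 0 := fun i => by
    have := (le_abs_self _).trans (hcov i 0)
    simpa [sq] using this
  have hcard : ∀ N : ℕ, (N + 1) ^ 2 - N ^ 2 = 2 * N + 1 := fun N => by
    rw [add_sq]
    omega
  have hB2 : ∀ N : ℕ, ∫ ω, B N ω ^ 2 ∂P ≤ (2 * N + 1) ^ 2 * a 0 := fun N => by
    calc ∫ ω, B N ω ^ 2 ∂P
        ≤ ∫ ω, (2 * N + 1 : ℝ) * ∑ i ∈ Finset.Ico (N ^ 2) ((N + 1) ^ 2), Z i ω ^ 2 ∂P := by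
          refine integral_mono (hBm N).integrable_sq
            ((integrable_finsetSum _ fun i _ => (hZ i).integrable_sq).const_mul _) fun ω => ?_
          have := sq_sum_le_card_mul_sum_sq (s := Finset.Ico (N ^ 2) ((N + 1) ^ 2))
            (f := fun i => |Z i ω|)
          simpa [hB, hcard] using this
      _ = (2 * N + 1) * ∑ i ∈ Finset.Ico (N ^ 2) ((N + 1) ^ 2), ∫ ω, Z i ω ^ 2 ∂P := by
          rw [integral_const_mul, integral_finsetSum _ fun i _ => (hZ i).integrable_sq]
      _ ≤ (2 * N + 1) * ∑ i ∈ Finset.Ico (N ^ 2) ((N + 1) ^ 2), a 0 := by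
          gcongr with i
          exact hZ2 i
      _ = (2 * N + 1) ^ 2 * a 0 := by
          rw [Finset.sum_const, Nat.card_Ico, hcard, nsmul_eq_mul]
          push_cast
          ring
  -- `R N` dominates every average with `N ^ 2 ≤ n < (N + 1) ^ 2`, so convergence along squares
  -- suffices.
  set R : ℕ → Ω → ℝ := fun N ω => (|S (N ^ 2) ω| + B N ω) / (N : ℝ) ^ 2 with hR
  have hRm : ∀ N, MemLp (R N) 2 P := fun N => by
    have := ((hSm (N ^ 2)).abs.add (hBm N)).mul_const (((N : ℝ) ^ 2)⁻¹)
    simpa [hR, div_eq_mul_inv] using this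
  -- `22 = 2 * (2 + 9)`: the factor 2 splits the square, 2 is from the sum up to `N ^ 2`, and 9 from
  -- `2 * N + 1 ≤ 3 * N`. At `N = 0` both sides are 0, division by zero being 0.
  have hR2 : ∀ N : ℕ, ∫ ω, R N ω ^ 2 ∂P ≤ 22 * A * (1 / (N : ℝ) ^ 2) := fun N => by
    rcases Nat.eq_zero_or_pos N with rfl | hN
    · simp [hR]
    have hN1 : (1 : ℝ) ≤ N := by exact_mod_cast hN
    calc ∫ ω, R N ω ^ 2 ∂P
        ≤ ∫ ω, (S (N ^ 2) ω ^ 2 + B N ω ^ 2) * (2 / (N : ℝ) ^ 4) ∂P := by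
          refine integral_mono (hRm N).integrable_sq
            (((hSm _).integrable_sq.add (hBm N).integrable_sq).mul_const _) fun ω => ?_
          simp only [hR, div_pow]
          rw [← pow_mul, ← mul_div_assoc]
          gcongr
          nlinarith [sq_nonneg (|S (N ^ 2) ω| - B N ω), sq_abs (S (N ^ 2) ω)]
      _ = (∫ ω, S (N ^ 2) ω ^ 2 ∂P + ∫ ω, B N ω ^ 2 ∂P) * (2 / (N : ℝ) ^ 4) := by
          rw [integral_mul_const, integral_add (hSm _).integrable_sq (hBm N).integrable_sq]
      _ ≤ (2 * A * (N : ℝ) ^ 2 + (3 * N) ^ 2 * A) * (2 / (N : ℝ) ^ 4) := by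
          have h1 := integral_sum_sq_le hZ ha0 ha hcov (N ^ 2)
          push_cast at h1
          have h2 : (2 * N + 1 : ℝ) ^ 2 * a 0 ≤ (3 * N) ^ 2 * A := by
            have := ha0 0
            gcongr
            linarith
          have h3 := hB2 N
          have h4 : ∫ ω, S (N ^ 2) ω ^ 2 ∂P ≤ 2 * A * (N : ℝ) ^ 2 := h1
          gcongr
          linarith
      _ = 22 * A * (1 / (N : ℝ) ^ 2) := by
          field_simp
          ring
  have hsummable : Summable fun N : ℕ => 22 * A * (1 / (N : ℝ) ^ 2) :=
    (Real.summable_one_div_nat_pow.2 (by norm_num)).mul_left _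
  filter_upwards [tendsto_zero_of_summable_integral_sq hRm hsummable hR2] with ω hω
  have hsqrt : Tendsto Nat.sqrt atTop atTop :=
    tendsto_atTop_mono' atTop (Eventually.of_forall fun n => le_rfl)
      (tendsto_atTop_atTop.2 fun b => ⟨b * b, fun n hn => Nat.le_sqrt.2 hn⟩)
  refine squeeze_zero_norm' (eventually_atTop.2 ⟨1, fun n hn => ?_⟩) (hω.comp hsqrt)
  set N := Nat.sqrt n with hN
  have hN0 : 0 < N := Nat.sqrt_pos.2 hn
  have h1 : N ^ 2 ≤ n := Nat.sqrt_le' n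
  have h2 : n < (N + 1) ^ 2 := Nat.lt_succ_sqrt' n
  have h3 : |∑ i ∈ Finset.range n, Z i ω| ≤ |S (N ^ 2) ω| + B N ω := by
    rw [← Finset.sum_range_add_sum_Ico _ h1]
    refine (abs_add_le _ _).trans (add_le_add le_rfl ?_)
    refine (Finset.abs_sum_le_sum_abs _ _).trans ?_
    exact Finset.sum_le_sum_of_subset_of_nonneg
      (Finset.Ico_subset_Ico le_rfl h2.le) fun i _ _ => abs_nonneg _
  have h4 : ((N : ℝ)) ^ 2 ≤ n := by exact_mod_cast h1
  have hN0' : (0 : ℝ) < N := by exact_mod_cast hN0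
  rw [Real.norm_eq_abs, abs_mul, abs_of_nonneg (by positivity), one_div_mul_eq_div]
  exact div_le_div₀ ((abs_nonneg _).trans h3) h3 (by positivity) h4

end StrongLaw

/-! ### Lower moments at a prescribed scale. -/

section WeightedMoments

variable {Ω F : Type*} [MeasurableSpace Ω] {P : Measure Ω} [IsProbabilityMeasure P]
  [NormedAddCommGroup F] [MeasurableSpace F] [BorelSpace F]

lemma rpow_le_mul_one_add_div {x l a q : ℝ} (hx : 0 < x) (hl : 0 < l) (ha : 0 ≤ a) (haq : a ≤ q) :
    x ^ a ≤ l ^ a * (1 + x ^ q / l ^ q) := by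
  rw [← Real.div_rpow hx.le hl.le]
  have h0 : 0 < x / l := by positivity
  have h1 : (x / l) ^ a ≤ 1 + (x / l) ^ q := by
    rcases le_total (x / l) 1 with h | h
    · linarith [Real.rpow_le_one h0.le h ha, Real.rpow_nonneg h0.le q]
    · linarith [Real.rpow_le_rpow_of_exponent_le h haq]
  calc x ^ a = l ^ a * (x / l) ^ a := by
        rw [← Real.mul_rpow hl.le h0.le, mul_div_cancel₀ _ hl.ne']
    _ ≤ _ := by gcongr

lemma one_add_rpow_le {x q : ℝ} (hx : 0 ≤ x) (hq : 0 ≤ q) :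
    (1 + x) ^ q ≤ 2 ^ q * (1 + x ^ q) := by
  have h0 : 0 ≤ x ^ q := by positivity
  rcases le_total x 1 with h | h
  · calc (1 + x) ^ q ≤ 2 ^ q := by
          gcongr
          linarith
      _ ≤ 2 ^ q * (1 + x ^ q) := le_mul_of_one_le_right (by positivity) (by linarith)
  · calc (1 + x) ^ q ≤ (2 * x) ^ q := by
          gcongr
          linarith
      _ = 2 ^ q * x ^ q := Real.mul_rpow (by norm_num) hx
      _ ≤ 2 ^ q * (1 + x ^ q) := by
          gcongr
          linarith

/-- Lower order moments obtained from a bound on the moment of order `q`. -/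
lemma integral_one_add_norm_rpow_le {V : Ω → F} (hV : Measurable V) {q a L l : ℝ} (ha : 0 ≤ a)
    (haq : a ≤ q) (hL : 0 ≤ L) (hl : 1 ≤ l)
    (h : ∫⁻ ω, ENNReal.ofReal (‖V ω‖ ^ q) ∂P ≤ ENNReal.ofReal (L * l ^ q)) :
    Integrable (fun ω => (1 + ‖V ω‖) ^ a) P ∧
      ∫ ω, (1 + ‖V ω‖) ^ a ∂P ≤ (1 + 2 ^ q * (1 + L)) * l ^ a := by
  have hq : 0 ≤ q := ha.trans haq
  have hl0 : 0 < l := by linarith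
  obtain ⟨h1, h2⟩ := integrable_of_lintegral_ofReal_le (hV.norm.pow_const q)
    (fun _ => by positivity) (by positivity) h
  -- Dividing by the scale `l` before comparing exponents makes the bound proportional to `l ^ a`,
  -- with a constant independent of `a` and `l`.
  have hpt : ∀ ω, (1 + ‖V ω‖) ^ a ≤ l ^ a * (1 + 2 ^ q * (1 + ‖V ω‖ ^ q) / l ^ q) := fun ω => by
    have := norm_nonneg (V ω)
    refine (rpow_le_mul_one_add_div (q := q) (by positivity) hl0 ha haq).trans ?_
    have := one_add_rpow_le (norm_nonneg (V ω)) hq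
    gcongr
  have hb : Integrable (fun ω => l ^ a * (1 + 2 ^ q * (1 + ‖V ω‖ ^ q) / l ^ q)) P :=
    ((integrable_const 1).add ((((integrable_const 1).add h1).const_mul _).div_const _)).const_mul _
  have hi : Integrable (fun ω => (1 + ‖V ω‖) ^ a) P :=
    hb.mono' ((hV.norm.const_add 1).pow_const a).aestronglyMeasurable
      (Eventually.of_forall fun ω => by
        rw [Real.norm_of_nonneg (by positivity)]
        exact hpt ω)
  refine ⟨hi, (integral_mono hi hb hpt).trans ?_⟩
  have hlq : 1 ≤ l ^ q := Real.one_le_rpow hl hq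
  have hi1 : Integrable (fun ω => 1 + ‖V ω‖ ^ q) P := (integrable_const 1).add h1
  have hi2 : Integrable (fun ω => 2 ^ q * (1 + ‖V ω‖ ^ q) / l ^ q) P :=
    (hi1.const_mul _).div_const _
  rw [integral_const_mul, integral_add (integrable_const 1) hi2, integral_div, integral_const_mul,
    integral_add (integrable_const 1) h1]
  simp only [integral_const, probReal_univ, smul_eq_mul, mul_one]
  rw [mul_comm]
  gcongr
  rw [div_le_iff₀ (by positivity), mul_assoc]
  gcongr
  nlinarith

lemma abs_le_two_mul_weight {x N y p : ℝ} (hx : 0 ≤ x) (hp : 0 ≤ p) (hN : 0 ≤ N)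
    (h : |y| ≤ N * (1 + x ^ (p / 2))) : |y| ≤ 2 * N * (1 + x) ^ (p / 2) := by
  have h1 : 1 ≤ (1 + x) ^ (p / 2) := Real.one_le_rpow (by linarith) (by positivity)
  have h2 : x ^ (p / 2) ≤ (1 + x) ^ (p / 2) :=
    Real.rpow_le_rpow hx (by linarith) (by positivity)
  nlinarith

/-- Functions of growth `p / 2` are square integrable when moments of order `q ≥ p` exist. -/
lemma memLp_two_of_growth {V : Ω → F} (hV : Measurable V) {q p L l N : ℝ} (hp : 0 ≤ p)
    (hpq : p ≤ q) (hL : 0 ≤ L) (hl : 1 ≤ l)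
    (h : ∫⁻ ω, ENNReal.ofReal (‖V ω‖ ^ q) ∂P ≤ ENNReal.ofReal (L * l ^ q))
    {f : F → ℝ} (hf : Measurable f) (hN : 0 ≤ N) (hfN : ∀ u, |f u| ≤ N * (1 + ‖u‖ ^ (p / 2))) :
    MemLp (fun ω => f (V ω)) 2 P ∧ ∫⁻ ω, ENNReal.ofReal (f (V ω) ^ 2) ∂P ≤
      ENNReal.ofReal ((2 * N) ^ 2 * ((1 + 2 ^ q * (1 + L)) * l ^ p)) := by
  obtain ⟨h1, h2⟩ := integral_one_add_norm_rpow_le hV hp hpq hL hl h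
  have hpt : ∀ ω, f (V ω) ^ 2 ≤ (2 * N) ^ 2 * (1 + ‖V ω‖) ^ p := fun ω => by
    have h3 := abs_le_two_mul_weight (norm_nonneg (V ω)) hp hN (hfN (V ω))
    have h4 : ((1 + ‖V ω‖) ^ (p / 2)) ^ 2 = (1 + ‖V ω‖) ^ p := by
      rw [← Real.rpow_natCast, ← Real.rpow_mul (by positivity)]
      norm_num
    rw [← h4, ← mul_pow, ← sq_abs]
    gcongr
  have hm : Measurable fun ω => f (V ω) := hf.comp hV
  constructor
  · refine (memLp_two_iff_integrable_sq hm.aestronglyMeasurable).2 ?_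
    refine (h1.const_mul ((2 * N) ^ 2)).mono' (hm.pow_const 2).aestronglyMeasurable
      (Eventually.of_forall fun ω => ?_)
    rw [Real.norm_of_nonneg (sq_nonneg _)]
    exact hpt ω
  · calc _ ≤ ∫⁻ ω, ENNReal.ofReal ((2 * N) ^ 2 * (1 + ‖V ω‖) ^ p) ∂P :=
          lintegral_mono fun ω => ENNReal.ofReal_le_ofReal (hpt ω)
      _ = ENNReal.ofReal (∫ ω, (2 * N) ^ 2 * (1 + ‖V ω‖) ^ p ∂P) :=
          (ofReal_integral_eq_lintegral_ofReal (h1.const_mul _)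
            (Eventually.of_forall fun ω => by positivity)).symm
      _ ≤ _ := by
          rw [integral_const_mul]
          gcongr

lemma integral_norm_rpow_le {V : Ω → F} (hV : Measurable V) {q p L l : ℝ} (hp : 0 ≤ p)
    (hpq : p ≤ q) (hL : 0 ≤ L) (hl : 1 ≤ l)
    (h : ∫⁻ ω, ENNReal.ofReal (‖V ω‖ ^ q) ∂P ≤ ENNReal.ofReal (L * l ^ q)) :
    Integrable (fun ω => ‖V ω‖ ^ p) P ∧
      ∫ ω, ‖V ω‖ ^ p ∂P ≤ (1 + 2 ^ q * (1 + L)) * l ^ p := by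
  obtain ⟨h1, h2⟩ := integral_one_add_norm_rpow_le hV hp hpq hL hl h
  have hpt : ∀ ω, ‖V ω‖ ^ p ≤ (1 + ‖V ω‖) ^ p := fun ω => by
    gcongr
    linarith
  have hi : Integrable (fun ω => ‖V ω‖ ^ p) P :=
    h1.mono' (hV.norm.pow_const p).aestronglyMeasurable (Eventually.of_forall fun ω => by
      rw [Real.norm_of_nonneg (by positivity)]
      exact hpt ω)
  exact ⟨hi, (integral_mono hi h1 hpt).trans h2⟩

end WeightedMoments

/-! ### Mixing chains: contraction and the strong law. -/

section Chain

variable {Ω F : Type*} [MeasurableSpace Ω] {P : Measure Ω} [NormedAddCommGroup F]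
  [MeasurableSpace F]

/-- Polynomial moment bound and mixing for a Markov chain. -/
structure IsMixingChain (P : Measure Ω) (Y : F → ℕ → Ω → F) (q qt L κ L' : ℝ) (ρ : ℕ → ℝ) :
    Prop where
  markov : IsMarkovFamily P Y
  q_pos : 0 < q
  one_le_qt : 1 ≤ qt
  L_nonneg : 0 ≤ L
  moment : ∀ u k, ∫⁻ ω, ENNReal.ofReal (‖Y u k ω‖ ^ q) ∂P ≤
    ENNReal.ofReal (L * (1 + ‖u‖ ^ (qt * q)))
  κ_nonneg : 0 ≤ κ
  L'_nonneg : 0 ≤ L'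
  ρ_nonneg : ∀ k, 0 ≤ ρ k
  mixing : ∀ u v k, eLpNorm (fun ω => Y u k ω - Y v k ω) 2 P ≤
    ENNReal.ofReal (L' * ‖u - v‖ * (1 + ‖u‖ ^ κ + ‖v‖ ^ κ) * ρ k)

namespace IsMixingChain

variable {Y : F → ℕ → Ω → F} {q qt L κ L' : ℝ} {ρ : ℕ → ℝ}

lemma moment_zero (hY : IsMixingChain P Y q qt L κ L' ρ) (k : ℕ) :
    ∫⁻ ω, ENNReal.ofReal (‖Y 0 k ω‖ ^ q) ∂P ≤ ENNReal.ofReal L := by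
  have h : 0 < qt * q := mul_pos (by linarith [hY.one_le_qt]) hY.q_pos
  simpa [Real.zero_rpow h.ne'] using hY.moment 0 k

/-- Puts the moment bound into the form `L * l ^ q` with scale `l = (1 + ‖u‖) ^ qt`; the factor 2
absorbs the additive 1. -/
lemma moment_weight (hY : IsMixingChain P Y q qt L κ L' ρ) (u : F) (k : ℕ) :
    ∫⁻ ω, ENNReal.ofReal (‖Y u k ω‖ ^ q) ∂P ≤
      ENNReal.ofReal (2 * L * ((1 + ‖u‖) ^ qt) ^ q) := by
  refine (hY.moment u k).trans (ENNReal.ofReal_le_ofReal ?_)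
  have h0 := hY.one_le_qt
  have h2 := hY.q_pos
  have h3 := hY.L_nonneg
  rw [← Real.rpow_mul (by positivity)]
  have h4 : 1 ≤ (1 + ‖u‖) ^ (qt * q) :=
    Real.one_le_rpow (by linarith [norm_nonneg u]) (by positivity)
  have h5 : ‖u‖ ^ (qt * q) ≤ (1 + ‖u‖) ^ (qt * q) := by
    gcongr
    linarith
  nlinarith

lemma one_le_weight (hY : IsMixingChain P Y q qt L κ L' ρ) (u : F) : 1 ≤ (1 + ‖u‖) ^ qt :=
  Real.one_le_rpow (by linarith [norm_nonneg u]) (by linarith [hY.one_le_qt])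

variable [IsProbabilityMeasure P] [SecondCountableTopology F] [BorelSpace F]

theorem exists_isUniqueInvariantProb [CompleteSpace F] (hY : IsMixingChain P Y q qt L κ L' ρ)
    (hκ : 1 + κ ≤ q) (hρ : Tendsto ρ atTop (𝓝 0)) :
    ∃ ν : ProbabilityMeasure F, IsUniqueInvariantProb P Y (ν : Measure F) ∧
      Tendsto (fun n => hY.markov.law 0 n) atTop (𝓝 ν) :=
  hY.markov.exists_isUniqueInvariantProb (c := fun k => L' * ρ k) (s := id) hY.κ_nonneg hκ
    hY.L_nonneg (fun k => mul_nonneg hY.L'_nonneg (hY.ρ_nonneg k))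
    (fun x y k => by
      convert hY.mixing x y k using 2
      ring) hY.moment_zero
    (by simpa using hρ.const_mul L')

/-- Contraction of the transition operator on functions with a weighted Hölder bound. -/
lemma abs_integral_sub_le (hY : IsMixingChain P Y q qt L κ L' ρ) {p γ N : ℝ} (hp : 0 ≤ p)
    (hpq : p ≤ q) (hγ : 0 < γ) (hγ1 : γ ≤ 1) (hN : 0 ≤ N) {f : F → ℝ} (hf : Measurable f)
    (hfN : ∀ u, |f u| ≤ N * (1 + ‖u‖ ^ (p / 2)))
    (hfH : ∀ u v, |f u - f v| ≤ N * (‖u - v‖ ^ γ * √(1 + ‖u‖ ^ p + ‖v‖ ^ p))) (u v : F) (k : ℕ) :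
    |∫ ω, f (Y u k ω) ∂P - ∫ ω, f (Y v k ω) ∂P| ≤
      N * ((3 * L') ^ γ * √(3 * (1 + 2 ^ q * (1 + 2 * L)))) * ρ k ^ γ *
        ((1 + ‖u‖) ^ ((1 + κ) * γ + qt * p / 2) * (1 + ‖v‖) ^ ((1 + κ) * γ + qt * p / 2)) := by
  have hL := hY.L_nonneg
  have hL' := hY.L'_nonneg
  have hκ := hY.κ_nonneg
  have hρ := hY.ρ_nonneg k
  have hqt := hY.one_le_qt
  have h2L : 0 ≤ 2 * L := by positivity
  set C := 1 + 2 ^ q * (1 + 2 * L) with hC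
  have hC1 : 1 ≤ C := by
    rw [hC]
    linarith [show 0 ≤ (2 : ℝ) ^ q * (1 + 2 * L) by positivity]
  have hfi : ∀ w, Integrable (fun ω => f (Y w k ω)) P := fun w =>
    (memLp_two_of_growth (hY.markov.measurable w k) hp hpq h2L (hY.one_le_weight w)
      (hY.moment_weight w k) hf hN hfN).1.integrable (by norm_num)
  have hmom := fun w => integral_norm_rpow_le (hY.markov.measurable w k) hp hpq h2L
    (hY.one_le_weight w) (hY.moment_weight w k)
  -- A single weight dominating both points. The mean-square distance contributes the exponent `(1 +
  -- κ) * γ`, and the root of the `p`-th moments contributes `qt * p / 2`.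
  set s := (1 + ‖u‖) * (1 + ‖v‖) with hs
  have hu := norm_nonneg u
  have hv := norm_nonneg v
  have hus : 1 + ‖u‖ ≤ s := by rw [hs]; nlinarith
  have hvs : 1 + ‖v‖ ≤ s := by rw [hs]; nlinarith
  have hs1 : 1 ≤ s := by linarith
  have hs0 : 0 < s := by linarith
  have hpow : ∀ w : F, 1 + ‖w‖ ≤ s → ((1 + ‖w‖) ^ qt) ^ p ≤ s ^ (qt * p) := fun w hw => by
    rw [← Real.rpow_mul (by positivity)]
    gcongr
  have hd : L' * ‖u - v‖ * (1 + ‖u‖ ^ κ + ‖v‖ ^ κ) * ρ k ≤ 3 * L' * s ^ (1 + κ) * ρ k := by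
    have h1 : ‖u - v‖ ≤ s := (norm_sub_le u v).trans (by rw [hs]; nlinarith)
    have h2 : ‖u‖ ^ κ ≤ s ^ κ := by
      gcongr
      linarith
    have h3 : ‖v‖ ^ κ ≤ s ^ κ := by
      gcongr
      linarith
    have h4 : 1 ≤ s ^ κ := Real.one_le_rpow hs1 hκ
    rw [Real.rpow_add hs0, Real.rpow_one]
    calc L' * ‖u - v‖ * (1 + ‖u‖ ^ κ + ‖v‖ ^ κ) * ρ k ≤ L' * s * (3 * s ^ κ) * ρ k := by
          gcongr
          linarith
      _ = 3 * L' * (s * s ^ κ) * ρ k := by ring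
  have h := abs_integral_sub_le_of_weighted_holder
    (hY.markov.measurable u k).aestronglyMeasurable (hY.markov.measurable v k).aestronglyMeasurable
    (d := 3 * L' * s ^ (1 + κ) * ρ k) (by positivity) hγ hγ1
    ((hY.mixing u v k).trans (ENNReal.ofReal_le_ofReal hd)) hN hfH (hfi u) (hfi v)
    (hmom u).1 (hmom v).1 ((hmom u).2.trans (mul_le_mul_of_nonneg_left (hpow u hus) (by positivity)))
    ((hmom v).2.trans (mul_le_mul_of_nonneg_left (hpow v hvs) (by positivity)))
  refine h.trans ?_
  have h1 : (3 * L' * s ^ (1 + κ) * ρ k) ^ γ = (3 * L') ^ γ * s ^ ((1 + κ) * γ) * ρ k ^ γ := by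
    rw [Real.mul_rpow (by positivity) hρ, Real.mul_rpow (by positivity) (by positivity),
      ← Real.rpow_mul hs0.le]
  have h2 : √(1 + C * s ^ (qt * p) + C * s ^ (qt * p)) ≤ √(3 * C) * s ^ (qt * p / 2) := by
    have h3 : 1 ≤ s ^ (qt * p) := Real.one_le_rpow hs1 (by positivity)
    have h4 : s ^ (qt * p / 2) = √(s ^ (qt * p)) := by
      rw [Real.sqrt_eq_rpow, ← Real.rpow_mul hs0.le]
      congr 1
      ring
    rw [h4, ← Real.sqrt_mul (by positivity)]
    refine Real.sqrt_le_sqrt ?_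
    nlinarith
  rw [← Real.mul_rpow (by positivity) (by positivity), ← hs, Real.rpow_add hs0 ((1 + κ) * γ),
    h1]
  calc N * ((3 * L') ^ γ * s ^ ((1 + κ) * γ) * ρ k ^ γ *
        √(1 + C * s ^ (qt * p) + C * s ^ (qt * p)))
      ≤ N * ((3 * L') ^ γ * s ^ ((1 + κ) * γ) * ρ k ^ γ * (√(3 * C) * s ^ (qt * p / 2))) := by
        gcongr
    _ = _ := by ring

/-- Strong law of large numbers for a mixing chain and a function with a weighted Hölder bound. -/
theorem tendsto_timeAverage (hY : IsMixingChain P Y q qt L κ L' ρ) {p γ N : ℝ} (hp : 0 ≤ p)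
    (hγ : 0 < γ) (hγ1 : γ ≤ 1) (hpq : p * (1 + qt) + 2 * (1 + κ) * γ ≤ q)
    (hρ : Summable fun k => ρ k ^ γ) (hN : 0 ≤ N) {f : F → ℝ} (hf : Measurable f)
    (hfN : ∀ u, |f u| ≤ N * (1 + ‖u‖ ^ (p / 2)))
    (hfH : ∀ u v, |f u - f v| ≤ N * (‖u - v‖ ^ γ * √(1 + ‖u‖ ^ p + ‖v‖ ^ p)))
    {ν : Measure F} (hν : IsInvariantProb P Y ν)
    (hνq : ∫⁻ y, ENNReal.ofReal (‖y‖ ^ q) ∂ν ≤ ENNReal.ofReal L) (u : F) :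
    ∀ᵐ ω ∂P, Tendsto (timeAverage f (Y u) ω) atTop (𝓝 (∫ y, f y ∂ν)) := by
  have := hν.1
  have hL := hY.L_nonneg
  have hL' := hY.L'_nonneg
  have hκ := hY.κ_nonneg
  have hqt := hY.one_le_qt
  have h2L : 0 ≤ 2 * L := by positivity
  have hqtp : p ≤ qt * p := le_mul_of_one_le_left hp hqt
  have hκγ : 0 ≤ (1 + κ) * γ := by positivity
  have hpq' : p ≤ q := by nlinarith
  set C := 1 + 2 ^ q * (1 + 2 * L) with hC
  have hC0 : 0 ≤ C := by positivity
  set m := (1 + κ) * γ + qt * p / 2 with hm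
  have hm0 : 0 ≤ m := by positivity
  -- `p / 2 + m` is half the left side of `hpq`, and is the moment order met in the covariance
  -- bound.
  have hpm : p / 2 + m ≤ q := by rw [hm]; nlinarith
  have hνq' : ∫⁻ y, ENNReal.ofReal (‖id y‖ ^ q) ∂ν ≤ ENNReal.ofReal (2 * L * 1 ^ q) := by
    refine hνq.trans (ENNReal.ofReal_le_ofReal ?_)
    rw [Real.one_rpow]
    linarith
  have hfν : Integrable f ν :=
    (memLp_two_of_growth measurable_id hp hpq' h2L le_rfl hνq' hf hN hfN).1.integrable
      (by norm_num)
  obtain ⟨hwi, hw⟩ := integral_one_add_norm_rpow_le (a := m) measurable_id hm0 (by linarith) h2L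
    le_rfl hνq'
  have hfY : ∀ w k, MemLp (fun ω => f (Y w k ω)) 2 P := fun w k =>
    (memLp_two_of_growth (hY.markov.measurable w k) hp hpq' h2L (hY.one_le_weight w)
      (hY.moment_weight w k) hf hN hfN).1
  set D := N * ((3 * L') ^ γ * √(3 * C)) with hD
  have hD0 : 0 ≤ D := by positivity
  -- By invariance the mean of `f` is the `ν`-average of its expectations at time `k`, so the
  -- contraction estimate is averaged over the second starting point.
  have hrate : ∀ w k, |∫ ω, (f (Y w k ω) - ∫ y, f y ∂ν) ∂P| ≤
      D * C * ρ k ^ γ * (1 + ‖w‖) ^ m := fun w k => by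
    have hρk := hY.ρ_nonneg k
    have hPf : Integrable (fun y => ∫ ω, f (Y y k ω) ∂P) ν := by
      have h0 := (hwi.const_mul (D * ρ k ^ γ * (1 + ‖w‖) ^ m)).add
        (integrable_const |∫ ω, f (Y w k ω) ∂P|)
      refine h0.mono' (hY.markov.measurable_integral k hf).aestronglyMeasurable
        (Eventually.of_forall fun y => ?_)
      have h1 := hY.abs_integral_sub_le hp hpq' hγ hγ1 hN hf hfN hfH y w k
      have h2 := abs_sub_abs_le_abs_sub (∫ ω, f (Y y k ω) ∂P) (∫ ω, f (Y w k ω) ∂P)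
      simp only [Pi.add_apply, id, Real.norm_eq_abs]
      have h3 : N * ((3 * L') ^ γ * √(3 * C)) * ρ k ^ γ * ((1 + ‖y‖) ^ m * (1 + ‖w‖) ^ m) =
        D * ρ k ^ γ * (1 + ‖w‖) ^ m * (1 + ‖y‖) ^ m := by rw [hD]; ring
      linarith
    rw [integral_sub ((hfY w k).integrable (by norm_num)) (integrable_const _),
      integral_const, probReal_univ, one_smul, hν.integral_eq hY.markov k hf hfν]
    have h1 : ∫ ω, f (Y w k ω) ∂P = ∫ _, (∫ ω, f (Y w k ω) ∂P) ∂ν := by simp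
    rw [h1, ← integral_sub (integrable_const _) hPf]
    calc _ ≤ ∫ y, |∫ ω, f (Y w k ω) ∂P - ∫ ω, f (Y y k ω) ∂P| ∂ν := abs_integral_le_integral_abs
      _ ≤ ∫ y, D * ρ k ^ γ * (1 + ‖w‖) ^ m * (1 + ‖id y‖) ^ m ∂ν :=
          integral_mono ((integrable_const _).sub hPf).abs (hwi.const_mul _) fun y =>
            (hY.abs_integral_sub_le hp hpq' hγ hγ1 hN hf hfN hfH w y k).trans_eq (by
              simp only [id, hD]
              ring)
      _ ≤ D * ρ k ^ γ * (1 + ‖w‖) ^ m * (C * 1 ^ m) := by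
          rw [integral_const_mul]
          gcongr
      _ = _ := by
          rw [Real.one_rpow]
          ring
  set c := ∫ y, f y ∂ν with hc
  set H := 2 * N + |c| with hH
  have hfc : ∀ y, |f y - c| ≤ H * (1 + ‖y‖) ^ (p / 2) := fun y => by
    have h1 := abs_le_two_mul_weight (norm_nonneg y) hp hN (hfN y)
    have h2 : 1 ≤ (1 + ‖y‖) ^ (p / 2) :=
      Real.one_le_rpow (by linarith [norm_nonneg y]) (by positivity)
    have h3 := abs_sub (f y) c
    have h4 := le_mul_of_one_le_right (abs_nonneg c) h2
    rw [hH, add_mul]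
    linarith
  have hZ : ∀ i, MemLp (fun ω => f (Y u i ω) - c) 2 P := fun i =>
    (hfY u i).sub (memLp_const c)
  set A := H * (D * C) * (C * ((1 + ‖u‖) ^ qt) ^ (p / 2 + m)) with hA
  -- Conditioning at time `i` replaces the later factor by its mean from `Y u i`, which `hrate`
  -- bounds; the moments at time `i` are uniform in `i`.
  have hcov : ∀ i k, |∫ ω, (f (Y u i ω) - c) * (f (Y u (i + k) ω) - c) ∂P| ≤ A * ρ k ^ γ := by
    intro i k
    have hρk := hY.ρ_nonneg k
    obtain ⟨hvi, hv⟩ := integral_one_add_norm_rpow_le (a := p / 2 + m)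
      (hY.markov.measurable u i) (by positivity) hpm h2L (hY.one_le_weight u)
      (hY.moment_weight u i)
    rw [hY.markov.integral_mul u i k (g := fun y => f y - c) (f := fun y => f y - c)
      (hf.sub_const c) (hf.sub_const c) ((hZ i).integrable_mul (hZ (i + k)))]
    calc _ ≤ ∫ ω, |(f (Y u i ω) - c) * ∫ ω', (f (Y (Y u i ω) k ω') - c) ∂P| ∂P :=
          abs_integral_le_integral_abs
      _ ≤ ∫ ω, H * (D * C) * ρ k ^ γ * (1 + ‖Y u i ω‖) ^ (p / 2 + m) ∂P := by
          refine integral_mono_of_nonneg (Eventually.of_forall fun ω => abs_nonneg _)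
            (hvi.const_mul _) (Eventually.of_forall fun ω => ?_)
          simp only [abs_mul]
          rw [Real.rpow_add (by positivity)]
          calc _ ≤ (H * (1 + ‖Y u i ω‖) ^ (p / 2)) *
                (D * C * ρ k ^ γ * (1 + ‖Y u i ω‖) ^ m) :=
                mul_le_mul (hfc _) (hrate _ k) (abs_nonneg _) (by positivity)
            _ = _ := by ring
      _ ≤ H * (D * C) * ρ k ^ γ * (C * ((1 + ‖u‖) ^ qt) ^ (p / 2 + m)) := by
          rw [integral_const_mul]
          gcongr
      _ = A * ρ k ^ γ := by rw [hA]; ring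
  have hA0 : 0 ≤ A := by positivity
  filter_upwards [strong_law_of_summable_cov hZ
    (fun k => mul_nonneg hA0 (Real.rpow_nonneg (hY.ρ_nonneg k) γ)) (hρ.mul_left A) hcov] with ω hω
  have h1 := hω.add_const c
  rw [zero_add] at h1
  refine h1.congr' (eventually_atTop.2 ⟨1, fun n hn => ?_⟩)
  have hn0 : (n : ℝ) ≠ 0 := by
    have : 0 < n := hn
    positivity
  simp only [timeAverage, Finset.sum_sub_distrib, Finset.sum_const, Finset.card_range, nsmul_eq_mul]
  field_simp
  ring

end IsMixingChain

end Chain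

/-! ### Consequences of the assumptions. -/

section Assumptions

lemma tendsto_zero_of_summable_rpow {ρ : ℕ → ℝ} (hρ : ∀ k, 0 ≤ ρ k) {γ : ℝ} (hγ : 0 < γ)
    (h : Summable fun k => ρ k ^ γ) : Tendsto ρ atTop (𝓝 0) := by
  have h1 := h.tendsto_atTop_zero.rpow_const (p := γ⁻¹) (Or.inr (inv_nonneg.2 hγ.le))
  rw [Real.zero_rpow (inv_ne_zero hγ.ne')] at h1
  refine h1.congr fun k => ?_
  rw [← Real.rpow_mul (hρ k), mul_inv_cancel₀ hγ.ne', Real.rpow_one]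

/-- Summability forces `ρ k ≤ 1` eventually, where larger exponents give smaller powers. -/
lemma summable_rpow_of_le {ρ : ℕ → ℝ} (hρ : ∀ k, 0 ≤ ρ k) {γ γ' : ℝ} (hγ : 0 < γ) (hγ' : γ ≤ γ')
    (h : Summable fun k => ρ k ^ γ) : Summable fun k => ρ k ^ γ' := by
  refine Summable.of_norm_bounded_eventually_nat h ?_
  filter_upwards [(tendsto_zero_of_summable_rpow hρ hγ h).eventually_le_const zero_lt_one] with k hk
  rw [Real.norm_of_nonneg (Real.rpow_nonneg (hρ k) _)]
  rcases (hρ k).eq_or_lt with h0 | h0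
  · rw [← h0, Real.zero_rpow hγ.ne', Real.zero_rpow (by linarith)]
  · exact Real.rpow_le_rpow_of_exponent_ge h0 hk hγ'

/-- A nonnegative function whose power is integrable at infinity is small at arbitrarily large
times. -/
lemma exists_seq_tendsto_zero_of_integrableOn {ρ : ℝ → ℝ} (hρ : ∀ t, 0 ≤ t → 0 ≤ ρ t) {γ : ℝ}
    (hγ : 0 < γ) (hi : IntegrableOn (fun t => ρ t ^ γ) (Ici 0)) :
    ∃ s : ℕ → ℝ≥0, Tendsto (fun n => ρ (s n)) atTop (𝓝 0) ∧ ∀ n : ℕ, (n : ℝ) ≤ s n := by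
  have key : ∀ n : ℕ, ∃ t : ℝ≥0, (n : ℝ) ≤ t ∧ ρ t ≤ 1 / ((n : ℝ) + 1) := by
    intro n
    -- Otherwise the integrand stays above a positive constant on a half-line of infinite measure.
    by_contra! hcon
    set e := (1 / ((n : ℝ) + 1)) ^ γ with he
    have he0 : 0 < e := by positivity
    have hn : IntegrableOn (fun t => ρ t ^ γ) (Ici (n : ℝ)) :=
      hi.mono_set (Ici_subset_Ici.2 n.cast_nonneg)
    have hc : IntegrableOn (fun _ : ℝ => e) (Ici (n : ℝ)) := by
      refine Integrable.mono' hn aestronglyMeasurable_const ?_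
      filter_upwards [ae_restrict_mem measurableSet_Ici] with t ht
      have ht0 : 0 ≤ t := n.cast_nonneg.trans ht
      rw [Real.norm_of_nonneg he0.le]
      exact Real.rpow_le_rpow (by positivity) (hcon ⟨t, ht0⟩ ht).le hγ.le
    rw [integrableOn_const_iff] at hc
    rcases hc with hc | hc
    · exact he0.ne' (enorm_eq_zero.1 hc)
    · simp at hc
  choose s hs hs' using key
  exact ⟨s, squeeze_zero (fun n => hρ _ (s n).2) hs' tendsto_one_div_add_atTop_nhds_zero_nat, hs⟩

/-- Mean-square convergence gives an almost surely convergent subsequence, to which Fatou's lemma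
applies. -/
lemma lintegral_ofReal_norm_rpow_le_of_tendsto_eLpNorm {Ω E : Type*} [MeasurableSpace Ω]
    {P : Measure Ω} [NormedAddCommGroup E] [MeasurableSpace E] [BorelSpace E]
    [SecondCountableTopology E]
    {U : Ω → E} {W : ℕ → Ω → E} (hU : Measurable U) (hW : ∀ n, Measurable (W n)) {q : ℝ}
    (hq : 0 ≤ q) {B : ℝ≥0∞} (hB : ∀ n, ∫⁻ ω, ENNReal.ofReal (‖W n ω‖ ^ q) ∂P ≤ B)
    (h : Tendsto (fun n => eLpNorm (fun ω => U ω - W n ω) 2 P) atTop (𝓝 0)) :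
    ∫⁻ ω, ENNReal.ofReal (‖U ω‖ ^ q) ∂P ≤ B := by
  have h1 : TendstoInMeasure P W atTop U := by
    refine tendstoInMeasure_of_tendsto_eLpNorm (p := 2) (by norm_num)
      (fun n => (hW n).aestronglyMeasurable) hU.aestronglyMeasurable ?_
    refine h.congr fun n => ?_
    exact eLpNorm_sub_comm U (W n) 2 P
  obtain ⟨ns, -, hns⟩ := h1.exists_seq_tendsto_ae
  calc ∫⁻ ω, ENNReal.ofReal (‖U ω‖ ^ q) ∂P
      = ∫⁻ ω, liminf (fun n => ENNReal.ofReal (‖W (ns n) ω‖ ^ q)) atTop ∂P := by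
        refine lintegral_congr_ae ?_
        filter_upwards [hns] with ω hω
        exact (ENNReal.tendsto_ofReal (hω.norm.rpow_const (Or.inr hq))).liminf_eq.symm
    _ ≤ liminf (fun n => ∫⁻ ω, ENNReal.ofReal (‖W (ns n) ω‖ ^ q) ∂P) atTop :=
        lintegral_liminf_le fun n => ((hW _).norm.pow_const q).ennreal_ofReal
    _ ≤ B := (liminf_le_liminf (Eventually.of_forall fun n => hB (ns n))).trans_eq (by simp)

variable {Ω E : Type*} [MeasurableSpace Ω] {P : Measure Ω} [NormedAddCommGroup E]
  [NormedSpace ℝ E] [MeasurableSpace E] {V : ℝ → Submodule ℝ E}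
  {Y : (h τ : ℝ) → V h → ℕ → Ω → V h} {hmax τmax q qt L₃ γ₂ κ L₄ : ℝ} {ρΔ : ℝ → ℝ → ℝ → ℝ}

lemma DiscreteAssumption.isMixingChain
    (hY : DiscreteAssumption P V Y hmax τmax q qt L₃ γ₂ κ L₄ ρΔ) {h τ : ℝ} (hh : h ∈ Icc 0 hmax)
    (hτ : τ ∈ Ioc 0 τmax) :
    IsMixingChain P (Y h τ) q qt L₃ κ L₄ (fun k => ρΔ h τ (k * τ)) where
  markov := hY.markov h hh τ hτ
  q_pos := by linarith [hY.two_le_q]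
  one_le_qt := hY.one_le_qt
  L_nonneg := hY.L₃_pos.le
  moment := hY.moment h hh τ hτ
  κ_nonneg := hY.κ_mem.1
  L'_nonneg := hY.L₄_pos.le
  ρ_nonneg k := hY.ρΔ_nonneg h hh τ hτ _ (mul_nonneg k.cast_nonneg hτ.1.le)
  mixing := hY.mixing h hh τ hτ

lemma DiscreteAssumption.summable
    (hY : DiscreteAssumption P V Y hmax τmax q qt L₃ γ₂ κ L₄ ρΔ) {h τ : ℝ} (hh : h ∈ Icc 0 hmax)
    (hτ : τ ∈ Ioc 0 τmax) : Summable fun k : ℕ => ρΔ h τ (k * τ) ^ γ₂ := by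
  have h1 : ENNReal.ofReal τ * ∑' k : ℕ, ENNReal.ofReal (ρΔ h τ (k * τ) ^ γ₂) < ∞ :=
    lt_of_le_of_lt (le_iSup₂_of_le h hh (le_iSup₂_of_le (f := fun τ _ => ENNReal.ofReal τ *
      ∑' k : ℕ, ENNReal.ofReal (ρΔ h τ (k * τ) ^ γ₂)) τ hτ le_rfl)) hY.ρΔ_summable
  have h2 : ∑' k : ℕ, ENNReal.ofReal (ρΔ h τ (k * τ) ^ γ₂) ≠ ∞ := fun htop => by
    rw [htop, ENNReal.mul_top (ENNReal.ofReal_pos.2 hτ.1).ne'] at h1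
    exact lt_irrefl _ h1
  have h3 := ENNReal.summable_toReal h2
  refine h3.congr fun k => ENNReal.toReal_ofReal (Real.rpow_nonneg ?_ _)
  exact (hY.isMixingChain hh hτ).ρ_nonneg k

end Assumptions

/-! ### The numerical strong law. -/

theorem mainTheorem1 {Ω E : Type*} [MeasurableSpace Ω] (P : Measure Ω) [IsProbabilityMeasure P]
    [NormedAddCommGroup E] [NormedSpace ℝ E] [CompleteSpace E]
    [TopologicalSpace.SeparableSpace E] [MeasurableSpace E] [BorelSpace E]
    -- the exact process, the discrete state spaces, the discretization, the discrete initial data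
    (X : E → ℝ≥0 → Ω → E) (V : ℝ → Submodule ℝ E)
    (Y : (h τ : ℝ) → V h → ℕ → Ω → V h) (π : (h : ℝ) → E → V h)
    (hmax τmax : ℝ)
    (hV_zero : V 0 = ⊤) (hV_closed : ∀ h ∈ Icc 0 hmax, IsClosed (V h : Set E))
    (hπ : ∀ h ∈ Icc 0 hmax, ∀ u : V h, π h (u : E) = u)
    (r rt L₁ γ₁ β L₂ : ℝ) (ρ : ℝ → ℝ)
    (q qt L₃ γ₂ κ L₄ : ℝ) (ρΔ : ℝ → ℝ → ℝ → ℝ)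
    (α₁ α₂ L₅ : ℝ)
    (hX : ExactAssumption P X r rt L₁ γ₁ β L₂ ρ)
    (hY : DiscreteAssumption P V Y hmax τmax q qt L₃ γ₂ κ L₄ ρΔ)
    (hXY : StrongErrorAssumption P X V Y π hmax τmax rt qt α₁ α₂ L₅)
    (p γ : ℝ) (hγ : γ ∈ Icc γ₂ 1) (hp : 1 ≤ p)
    (hpq : p * (1 + qt) + 2 * (1 + κ) * γ ≤ q) :
    ∃ (μ : Measure E) (μΔ : (h : ℝ) → ℝ → Measure (V h)) (K : ℝ),
      IsUniqueInvariantProb P X μ ∧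
      (∀ h ∈ Icc 0 hmax, ∀ τ ∈ Ioc 0 τmax, IsUniqueInvariantProb P (Y h τ) (μΔ h τ)) ∧
      ∀ f : E → ℝ, MemTestSpace p γ f →
        Integrable f μ ∧
        (∀ h ∈ Icc 0 hmax, ∀ τ ∈ Ioc 0 τmax,
          Integrable (fun u : V h => f u) (μΔ h τ) ∧
          -- for fixed step size: almost sure convergence as the number of steps tends to infinity
          (∀ u : V h, ∀ᵐ ω ∂P,
            Tendsto (timeAverage f (fun i ω => (Y h τ u i ω : E)) ω) atTop
              (𝓝 (∫ v : V h, f v ∂(μΔ h τ)))) ∧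
          |∫ v, f v ∂μ - ∫ v : V h, f v ∂(μΔ h τ)|
            ≤ K * (testNorm p γ f).toReal * (h ^ α₁ + τ ^ α₂) ^ γ) ∧
        -- the inner limits converge as the step size tends to zero
        Tendsto (fun Δ : ℝ × ℝ => ∫ v : V Δ.1, f v ∂(μΔ Δ.1 Δ.2))
          (𝓝[stepSizes hmax τmax] ((0 : ℝ), (0 : ℝ))) (𝓝 (∫ v, f v ∂μ)) ∧
        -- the iterated limit, almost surely, along every sequence of step sizes tending to zero
        ∀ (x : E) (Δ : ℕ → ℝ × ℝ), (∀ n, Δ n ∈ stepSizes hmax τmax) →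
          Tendsto Δ atTop (𝓝 ((0 : ℝ), (0 : ℝ))) →
          ∀ᵐ ω ∂P, ∃ ℓ : ℕ → ℝ,
            (∀ n, Tendsto
              (timeAverage f (fun i ω => (Y (Δ n).1 (Δ n).2 (π (Δ n).1 x) i ω : E)) ω) atTop
              (𝓝 (ℓ n))) ∧
            Tendsto ℓ atTop (𝓝 (∫ v, f v ∂μ)) := by
  have : SecondCountableTopology E := UniformSpace.secondCountable_of_separable E
  have hγ₂ := hY.γ₂_mem.1
  have hγ0 : 0 < γ := hγ₂.trans_le hγ.1
  have hq := hY.two_le_q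
  have hqt := hY.one_le_qt
  have hκ := hY.κ_mem
  have hL₃ := hY.L₃_pos
  have hL₅ := hXY.L₅_pos
  have hp0 : 0 ≤ p := by linarith
  have hpq' : p ≤ q := by
    have : 0 ≤ 2 * (1 + κ) * γ := by
      have := hκ.1
      positivity
    nlinarith
  have hq0 : 0 ≤ q := by linarith
  -- invariant measures of the chains
  have hchain : ∀ h ∈ Icc 0 hmax, ∀ τ ∈ Ioc 0 τmax, ∃ ν : ProbabilityMeasure (V h),
      IsUniqueInvariantProb P (Y h τ) (ν : Measure (V h)) ∧
      ∃ hm : IsMarkovFamily P (Y h τ), Tendsto (fun n => hm.law 0 n) atTop (𝓝 ν) := by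
    intro h hh τ hτ
    have : CompleteSpace (V h) := (hV_closed h hh).completeSpace_coe
    have hc := hY.isMixingChain hh hτ
    obtain ⟨ν, h1, h2⟩ := hc.exists_isUniqueInvariantProb (by linarith [hκ.2])
      (tendsto_zero_of_summable_rpow hc.ρ_nonneg hγ₂ (hY.summable hh hτ))
    exact ⟨ν, h1, hc.markov, h2⟩
  -- the invariant measure of the exact process
  obtain ⟨s, hs0, hsn⟩ := exists_seq_tendsto_zero_of_integrableOn hX.ρ_nonneg hX.γ₁_mem.1
    hX.ρ_integrable
  have hrt : 0 < rt * r := mul_pos (by linarith [hX.one_le_rt]) (by linarith [hX.two_le_r])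
  obtain ⟨μ, hμ, hμs⟩ := hX.markov.exists_isUniqueInvariantProb (b := β) (m := r) (M := L₁)
    (c := fun t => L₂ * ρ t) (s := s) hX.β_mem.1 (by linarith [hX.β_mem.2]) hX.L₁_pos.le
    (fun t => mul_nonneg hX.L₂_pos.le (hX.ρ_nonneg t t.2))
    (fun x y t => by
      convert hX.mixing x y t using 2
      ring)
    (fun t => by simpa [Real.zero_rpow hrt.ne'] using hX.moment 0 t)
    (by simpa using hs0.const_mul L₂)
  have hmaxpow : (0 : ℝ) ^ max rt qt = 0 :=
    Real.zero_rpow (lt_of_lt_of_le (by linarith) (le_max_right rt qt)).ne'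
  have herr : ∀ h ∈ Icc 0 hmax, ∀ τ ∈ Ioc 0 τmax, ∀ t : ℝ≥0,
      eLpNorm (fun ω => X 0 t ω - (Y h τ 0 ⌊(t : ℝ) / τ⌋₊ ω : E)) 2 P ≤
        ENNReal.ofReal (L₅ * (h ^ α₁ + τ ^ α₂)) := by
    intro h hh τ hτ t
    have h1 := hXY.error h hh τ hτ 0 t
    have h2 : π h 0 = 0 := by simpa using hπ h hh 0
    simpa [h2, hmaxpow] using h1
  have hYE : ∀ h ∈ Icc 0 hmax, ∀ τ ∈ Ioc 0 τmax, ∀ k,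
      Measurable (fun ω => (Y h τ 0 k ω : E)) ∧
      ∫⁻ ω, ENNReal.ofReal (‖(Y h τ 0 k ω : E)‖ ^ q) ∂P ≤ ENNReal.ofReal L₃ := fun h hh τ hτ k =>
    ⟨measurable_subtype_coe.comp ((hY.markov h hh τ hτ).measurable 0 k),
      (hY.isMixingChain hh hτ).moment_zero k⟩
  have h0max : (0 : ℝ) ∈ Icc 0 hmax := ⟨le_rfl, hY.hmax_mem.1⟩
  -- `hX` gives moments of order `r`, not `q`. The order `q` is inherited from the chains with `h =
  -- 0` and `τ = τmax / (n + 1)`, whose strong error tends to 0.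
  have hXq : ∀ t, ∫⁻ ω, ENNReal.ofReal (‖X 0 t ω‖ ^ q) ∂P ≤ ENNReal.ofReal L₃ := by
    intro t
    have hτn : ∀ n : ℕ, τmax * (1 / ((n : ℝ) + 1)) ∈ Ioc 0 τmax := fun n => by
      have h1 := hY.τmax_mem.1
      refine ⟨by positivity, mul_le_of_le_one_right h1.le ?_⟩
      rw [div_le_one (by positivity)]
      linarith [n.cast_nonneg (α := ℝ)]
    refine lintegral_ofReal_norm_rpow_le_of_tendsto_eLpNorm (hX.markov.measurable 0 t)
      (fun n => (hYE 0 h0max _ (hτn n) _).1) hq0 (fun n => (hYE 0 h0max _ (hτn n) _).2)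
      (tendsto_of_tendsto_of_tendsto_of_le_of_le tendsto_const_nhds ?_ (fun n => zero_le)
        (fun n => herr 0 h0max _ (hτn n) t))
    have h1 : Tendsto (fun n : ℕ => τmax * (1 / ((n : ℝ) + 1))) atTop (𝓝 0) := by
      simpa using tendsto_one_div_add_atTop_nhds_zero_nat.const_mul τmax
    have h2 := (h1.rpow_const (p := α₂) (Or.inr hXY.α₂_pos.le)).const_mul L₅
    rw [Real.zero_rpow hXY.α₂_pos.ne', mul_zero] at h2
    have h3 := ENNReal.tendsto_ofReal h2
    simpa [Real.zero_rpow hXY.α₁_pos.ne'] using h3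
  have hone : ∀ L : ℝ, ENNReal.ofReal L = ENNReal.ofReal (L * 1 ^ q) := fun L => by simp
  have hμq : ∫⁻ y, ENNReal.ofReal (‖y‖ ^ q) ∂(μ : Measure E) ≤ ENNReal.ofReal L₃ :=
    lintegral_ofReal_le_of_tendsto hμs (continuous_norm.rpow_const fun _ => Or.inr hq0)
      (fun y => by positivity) fun n => by
        refine (lintegral_map ?_ (hX.markov.measurable 0 (s n))).trans_le (hXq (s n))
        exact (measurable_norm.pow_const q).ennreal_ofReal
  classical
  -- Outside the admissible step sizes `ν h τ` is an arbitrary probability measure.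
  choose! ν hν using fun h (hh : h ∈ Icc 0 hmax) τ (hτ : τ ∈ Ioc 0 τmax) => hchain h hh τ hτ
  have hνq : ∀ h ∈ Icc 0 hmax, ∀ τ ∈ Ioc 0 τmax,
      ∫⁻ y, ENNReal.ofReal (‖y‖ ^ q) ∂(ν h τ : Measure (V h)) ≤ ENNReal.ofReal L₃ := by
    intro h hh τ hτ
    obtain ⟨-, hm, hlim⟩ := hν h hh τ hτ
    refine lintegral_ofReal_le_of_tendsto hlim (continuous_norm.rpow_const fun _ => Or.inr hq0)
      (fun y => by positivity) fun n => ?_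
    refine (lintegral_map ?_ (hm.measurable 0 n)).trans_le
      ((hY.isMixingChain hh hτ).moment_zero n)
    exact (measurable_norm.pow_const q).ennreal_ofReal
  set C := 1 + 2 ^ q * (1 + L₃) with hC
  have hC0 : 0 ≤ C := by positivity
  -- `C` bounds the `p`-th moments of both processes from the origin, so the constant depends on
  -- neither the step size nor `f`.
  refine ⟨μ, fun h τ => ν h τ, L₅ ^ γ * √(1 + C + C), hμ, fun h hh τ hτ => (hν h hh τ hτ).1,
    fun f hf => ?_⟩
  set N := (testNorm p γ f).toReal with hN
  have hN0 : 0 ≤ N := ENNReal.toReal_nonneg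
  have hfm := hf.1.measurable
  have hfμ : Integrable f (μ : Measure E) :=
    (memLp_two_of_growth measurable_id hp0 hpq' hL₃.le le_rfl (hμq.trans_eq (hone _)) hfm hN0
      hf.abs_le).1.integrable (by norm_num)
  have hstep : ∀ h ∈ Icc 0 hmax, ∀ τ ∈ Ioc 0 τmax,
      Integrable (fun u : V h => f u) (ν h τ : Measure (V h)) ∧
      (∀ u : V h, ∀ᵐ ω ∂P, Tendsto (timeAverage f (fun i ω => (Y h τ u i ω : E)) ω) atTop
        (𝓝 (∫ v : V h, f v ∂(ν h τ : Measure (V h))))) ∧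
      |∫ v, f v ∂(μ : Measure E) - ∫ v : V h, f v ∂(ν h τ : Measure (V h))|
        ≤ L₅ ^ γ * √(1 + C + C) * N * (h ^ α₁ + τ ^ α₂) ^ γ := by
    intro h hh τ hτ
    have hc := hY.isMixingChain hh hτ
    obtain ⟨hinv, hm, hlim⟩ := hν h hh τ hτ
    have hgc : Continuous fun u : V h => f u := hf.1.comp continuous_subtype_val
    have hg : ∀ u : V h, |f u| ≤ N * (1 + ‖u‖ ^ (p / 2)) := fun u => hf.abs_le u
    refine ⟨(memLp_two_of_growth measurable_id hp0 hpq' hL₃.le le_rfl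
      ((hνq h hh τ hτ).trans_eq (hone _)) hgc.measurable hN0 hg).1.integrable (by norm_num),
      fun u => ?_, ?_⟩
    · exact hc.tendsto_timeAverage hp0 hγ0 hγ.2 hpq
        (summable_rpow_of_le hc.ρ_nonneg hγ₂ hγ.1 (hY.summable hh hτ)) hN0 hgc.measurable hg
        (fun u v => hf.abs_sub_le u v) hinv.1 (hνq h hh τ hτ) u
    · have hΔ0 : 0 ≤ h ^ α₁ + τ ^ α₂ :=
        add_nonneg (Real.rpow_nonneg hh.1 _) (Real.rpow_nonneg hτ.1.le _)
      -- The chain is read at the physical times `s n`, so both laws converge along one sequence on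
      -- which the strong error holds.
      have hkn : Tendsto (fun n => ⌊(s n : ℝ) / τ⌋₊) atTop atTop := by
        refine tendsto_nat_floor_atTop.comp (Tendsto.atTop_div_const hτ.1 ?_)
        exact tendsto_atTop_mono hsn tendsto_natCast_atTop_atTop
      have hB0 : 0 ≤ (2 * N) ^ 2 * (C * 1 ^ p) := by positivity
      have hlimX : Tendsto (fun n => ∫ ω, f (X 0 (s n) ω) ∂P) atTop
          (𝓝 (∫ v, f v ∂(μ : Measure E))) := by
        refine (tendsto_integral_of_sq_bounded hμs hf.1 hB0 fun n => ?_).congr fun n =>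
          hX.markov.integral_law _ _ hfm
        refine (lintegral_map (hfm.pow_const 2).ennreal_ofReal
          (hX.markov.measurable 0 (s n))).trans_le ?_
        exact (memLp_two_of_growth (hX.markov.measurable 0 (s n)) hp0 hpq' hL₃.le le_rfl
          ((hXq _).trans_eq (hone _)) hfm hN0 hf.abs_le).2
      have hlimY : Tendsto (fun n => ∫ ω, f (Y h τ 0 ⌊(s n : ℝ) / τ⌋₊ ω) ∂P) atTop
          (𝓝 (∫ v : V h, f v ∂(ν h τ : Measure (V h)))) := by
        refine (tendsto_integral_of_sq_bounded (hlim.comp hkn) hgc hB0 fun n => ?_).congr fun n =>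
          hm.integral_law _ _ hgc.measurable
        refine (lintegral_map (hgc.measurable.pow_const 2).ennreal_ofReal
          (hm.measurable 0 _)).trans_le ?_
        exact (memLp_two_of_growth (hm.measurable 0 _) hp0 hpq' hL₃.le le_rfl
          ((hc.moment_zero _).trans_eq (hone _)) hgc.measurable hN0 hg).2
      refine le_of_tendsto (hlimX.sub hlimY).abs (Eventually.of_forall fun n => ?_)
      obtain ⟨hYm, hYq⟩ := hYE h hh τ hτ ⌊(s n : ℝ) / τ⌋₊
      have hXm := hX.markov.measurable 0 (s n)
      have hX1 := integral_norm_rpow_le hXm hp0 hpq' hL₃.le le_rfl ((hXq (s n)).trans_eq (hone _))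
      have hY1 := integral_norm_rpow_le hYm hp0 hpq' hL₃.le le_rfl (hYq.trans_eq (hone _))
      rw [Real.one_rpow, mul_one] at hX1 hY1
      have hfin := abs_integral_sub_le_of_weighted_holder hXm.aestronglyMeasurable
        hYm.aestronglyMeasurable (mul_nonneg hL₅.le hΔ0) hγ0 hγ.2 (herr h hh τ hτ (s n)) hN0
        hf.abs_sub_le
        ((memLp_two_of_growth hXm hp0 hpq' hL₃.le le_rfl ((hXq _).trans_eq (hone _)) hfm hN0
          hf.abs_le).1.integrable (by norm_num))
        ((memLp_two_of_growth hYm hp0 hpq' hL₃.le le_rfl (hYq.trans_eq (hone _)) hfm hN0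
          hf.abs_le).1.integrable (by norm_num)) hX1.1 hY1.1 hX1.2 hY1.2
      refine hfin.trans_eq ?_
      rw [Real.mul_rpow hL₅.le hΔ0]
      ring
  have hlimΔ : Tendsto (fun Δ : ℝ × ℝ => ∫ v : V Δ.1, f v ∂(ν Δ.1 Δ.2 : Measure (V Δ.1)))
      (𝓝[stepSizes hmax τmax] ((0 : ℝ), (0 : ℝ))) (𝓝 (∫ v, f v ∂(μ : Measure E))) := by
    have hcont : Continuous fun Δ : ℝ × ℝ =>
        L₅ ^ γ * √(1 + C + C) * N * (Δ.1 ^ α₁ + Δ.2 ^ α₂) ^ γ :=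
      ((((continuous_fst.rpow_const fun _ => Or.inr hXY.α₁_pos.le).add
        (continuous_snd.rpow_const fun _ => Or.inr hXY.α₂_pos.le)).rpow_const
          fun _ => Or.inr hγ0.le).const_mul _)
    have h0 := hcont.tendsto ((0 : ℝ), (0 : ℝ))
    simp only [Real.zero_rpow hXY.α₁_pos.ne', Real.zero_rpow hXY.α₂_pos.ne', add_zero,
      Real.zero_rpow hγ0.ne', mul_zero] at h0
    refine tendsto_iff_dist_tendsto_zero.2 (squeeze_zero' (Eventually.of_forall fun _ =>
      dist_nonneg) ?_ (h0.mono_left nhdsWithin_le_nhds))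
    filter_upwards [self_mem_nhdsWithin] with Δ hΔ
    rw [dist_comm, Real.dist_eq]
    exact (hstep Δ.1 hΔ.1 Δ.2 hΔ.2).2.2
  refine ⟨hfμ, hstep, hlimΔ, fun x Δ hΔ hΔ0 => ?_⟩
  -- Countably many null sets are discarded; each inner limit is independent of the starting point.
  filter_upwards [ae_all_iff.2 fun n => (hstep _ (hΔ n).1 _ (hΔ n).2).2.1 (π (Δ n).1 x)] with ω hω
  exact ⟨_, hω, hlimΔ.comp (tendsto_nhdsWithin_iff.2 ⟨hΔ0, Eventually.of_forall hΔ⟩)⟩
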